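/- Let $n\ge 1$, let $V$ be a set of $n$ vertices with a start vertex $s\in V$, and let $E=\{(u,v)\in V\times V: u\ne v\}$ be the edge set of the complete digraph on $V$. A weight assignment is a function $\ell:E\to\mathbb Z$, and the distance from $s$ to $v$ is the minimum length of a simple path from $s$ to $v$. A deterministic query/relaxation algorithm with edge queries is a finite decision tree that works on values $D[v]$ ($v\in V$), initially $D[s]=0$ and $D[v]=\ell_{sv}$ for $v\neq s$. Each internal node is either an edge query "$D[u]+\ell_{uv}<D[v]$?" for some edge $(u,v)$, with a "yes" branch and a "no" branch, or a relaxation update $D[v]:=\min\{D[v],D[u]+\ell_{uv}\}$ for some edge $(u,v)$, with one branch; each leaf is a relaxation update. The algorithm is correct on a class of weight assignments if, for every $\ell$ in the class, after the update at the leaf that is reached, every $D[v]$ equals the distance from $s$ to $v$. Its running time on $\ell$ is the number of steps (queries and updates) performed until every $D[v]$ equals the distance from $s$ to $v$. A randomized algorithm is a probability distribution on deterministic algorithms; it is correct on a class if every algorithm in its support is. (a) There are constants $c>0$, $C$ and $n_0$ such that for all $n\ge n_0$ and every $s$ the following holds. Let $\mathcal A$ be a deterministic query/relaxation algorithm with edge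 queries that is correct on all symmetric weight assignments ($\ell_{uv}=\ell_{vu}$) with integer weights in $[0,Cn]$. Then there is such a weight assignment on which the running time of $\mathcal A$ is at least $c\,n^3$. (b) There are constants $c>0$, $C$ and $n_0$ such that for all $n\ge n_0$ and every $s$ the following holds. Let $\mathcal R$ be a randomized query/relaxation algorithm with edge queries that is correct on all symmetric weight assignments with integer weights in $[0,Cn^2]$. Then there is such a weight assignment on which the expected running time of $\mathcal R$ is at least $c\,n^3$. In particular, both lower bounds hold for algorithms that are correct on all weight assignments without negative cycles. -/

import Mathlib

open scoped ENNReal NNReal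

namespace QueryRelaxation

/-- The edges of the complete digraph on the vertex set `Fin n`: ordered pairs of distinct
vertices. -/
abbrev Edge (n : ℕ) : Type := {e : Fin n × Fin n // e.1 ≠ e.2}

/-- Tail of an edge: `u` for the edge `(u, v)`. -/
abbrev Edge.src {n : ℕ} (e : Edge n) : Fin n := e.1.1

/-- Head of an edge: `v` for the edge `(u, v)`. -/
abbrev Edge.dst {n : ℕ} (e : Edge n) : Fin n := e.1.2

/-- The edge `(v, u)` for the edge `(u, v)`. -/
def Edge.rev {n : ℕ} (e : Edge n) : Edge n := ⟨(e.dst, e.src), e.2.symm⟩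

/-- Integer weight assignments on the complete digraph. -/
abbrev Weight (n : ℕ) : Type := Edge n → ℤ

/-- The length of a simple path of the complete digraph. (Directed simple paths of the complete
digraph are the same as simple paths of the complete graph `⊤`; each step of the path is
traversed, and its weight is taken, in the direction of travel.) -/
def pathLength {n : ℕ} (ℓ : Weight n) {u v : Fin n}
    (p : (⊤ : SimpleGraph (Fin n)).Path u v) : ℤ :=
  ((p : (⊤ : SimpleGraph (Fin n)).Walk u v).darts.map fun d => ℓ ⟨d.toProd, d.adj.ne⟩).sum

/-- `d` is the distance from `u` to `v`: the length of a shortest simple path from `u` to `v`. -/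
def IsDistance {n : ℕ} (ℓ : Weight n) (u v : Fin n) (d : ℤ) : Prop :=
  IsLeast (Set.range fun p : (⊤ : SimpleGraph (Fin n)).Path u v => pathLength ℓ p) d

/-- Initial D-values: `D[s] = 0` and `D[v] = ℓ_{sv}` for `v ≠ s`. -/
def initD {n : ℕ} (ℓ : Weight n) (s : Fin n) : Fin n → ℤ :=
  fun v => if h : s = v then 0 else ℓ ⟨(s, v), h⟩

/-- Relaxation update `D[v] := min (D[v], D[u] + ℓ_{uv})` for the edge `e = (u, v)`. -/
def relaxD {n : ℕ} (ℓ : Weight n) (D : Fin n → ℤ) (e : Edge n) : Fin n → ℤ :=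
  Function.update D e.dst (min (D e.dst) (D e.src + ℓ e))

/-- Deterministic query/relaxation algorithms that use only edge queries, as decision trees.
An internal node is a relaxation update (one branch) or an edge query (a "yes" branch and a "no"
branch); each leaf is a relaxation update. -/
inductive DecisionTree (n : ℕ) : Type
  | leaf (e : Edge n) : DecisionTree n
  | relax (e : Edge n) (next : DecisionTree n) : DecisionTree n
  | query (e : Edge n) (yes no : DecisionTree n) : DecisionTree n

/-- The D-values after the first `t` steps of the computation of a decision tree on weights `ℓ`,
started with D-values `D`. Every query and every update is one step; the edge query for `(u, v)`
asks whether `D[u] + ℓ_{uv} < D[v]`. After the update at a leaf the computation has stopped. -/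
def DecisionTree.run {n : ℕ} (ℓ : Weight n) : DecisionTree n → (Fin n → ℤ) → ℕ → (Fin n → ℤ)
  | _, D, 0 => D
  | .leaf e, D, _ + 1 => relaxD ℓ D e
  | .relax e next, D, t + 1 => next.run ℓ (relaxD ℓ D e) t
  | .query e yes no, D, t + 1 =>
      if D e.src + ℓ e < D e.dst then yes.run ℓ D t else no.run ℓ D t

/-- The D-values when the computation is complete, i.e. after the update at the leaf it reaches. -/
def DecisionTree.output {n : ℕ} (ℓ : Weight n) : DecisionTree n → (Fin n → ℤ) → (Fin n → ℤ)
  | .leaf e, D => relaxD ℓ D e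
  | .relax e next, D => next.output ℓ (relaxD ℓ D e)
  | .query e yes no, D =>
      if D e.src + ℓ e < D e.dst then yes.output ℓ D else no.output ℓ D

/-- The D-values are the correct distances from `s`. -/
def CorrectD {n : ℕ} (ℓ : Weight n) (s : Fin n) (D : Fin n → ℤ) : Prop :=
  ∀ v, IsDistance ℓ s v (D v)

/-- The algorithm `A` solves the single-source shortest path problem with start vertex `s` for all
weight assignments in `𝓛`: when its computation reaches a leaf, all D-values are correct. -/
def DecisionTree.Solves {n : ℕ} (A : DecisionTree n) (s : Fin n) (𝓛 : Set (Weight n)) : Prop :=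
  ∀ ℓ ∈ 𝓛, CorrectD ℓ s (A.output ℓ (initD ℓ s))

/-- The running time of `A` on `ℓ`: the number of steps until all D-values are correct
(`⊤` if this never happens, which is impossible for an algorithm that is correct on `ℓ`). -/
noncomputable def DecisionTree.runningTime {n : ℕ} (A : DecisionTree n) (s : Fin n)
    (ℓ : Weight n) : ℕ∞ :=
  ⨅ (t : ℕ) (_ : CorrectD ℓ s (A.run ℓ (initD ℓ s) t)), (t : ℕ∞)

/-- The expected running time on `ℓ` of a randomized algorithm, that is, of a probability
distribution `R` on decision trees. (There are only countably many decision trees, so `PMF`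
gives all probability distributions.) -/
noncomputable def expectedRunningTime {n : ℕ} (R : PMF (DecisionTree n)) (s : Fin n)
    (ℓ : Weight n) : ℝ≥0∞ :=
  ∑' A : DecisionTree n, R A * (A.runningTime s ℓ : ℝ≥0∞)

/-- The weight assignments that are non-negative, symmetric and bounded by `M`. -/
def nonnegSymm (n M : ℕ) : Set (Weight n) :=
  {ℓ | ∀ e, 0 ≤ ℓ e ∧ ℓ e ≤ M ∧ ℓ e.rev = ℓ e}

end QueryRelaxation

/-!
The lower bounds come from an adversary that hides a shortest path
`s = exit 0, entry 0, exit 1, entry 1, exit 2, …` in the graph and reveals it one pair of vertices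
at a time. The path edges have weight `g`. When `exit i` gets its final value, relaxing its edges
lowers every vertex that is not yet on the path to the common value `X - 1 - i`, except the next
vertex `entry i` of the path, which gets its small final value. All answers to queries are the same
as if `entry i` had been lowered to `X - 1 - i` as well (`Agree.relax`, `agree_config`), until the
algorithm queries or relaxes the one edge `(entry i, exit (i + 1))`. So with `k` pairs of the path
known, every ordered pair of free vertices can still be the next one, each step excludes only one
pair, and it does so only if it is taken after `exit k` has become final. As quadratically many
pairs are free during linearly many phases, this gives a cubic number of steps.

The argument needs that an edge of weight `g` between free vertices offers no improvement, that is,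
that the values of the free vertices stay within `g` of each other (`Spread`). For `g = n` this is
automatic, as the free vertices have at most `k + 1 ≤ n` different values; distances are then
quadratic in `n`. In this case the expected time of a randomized algorithm, averaged over the
choice of the next pair, grows by a quadratic amount in each phase (`sum_finalTime_extend`), so that
some choice achieves this. For `g = 1`, with linear distances, the adversary against a deterministic
algorithm chooses the pair that the algorithm excludes last; then all free vertices have been
lowered by `exit k` in that phase, which restores `Spread` (`spread_extend`).
-/

namespace QueryRelaxation

variable {n : ℕ}

/-! ### Computations as iterated steps -/

/-- A configuration of a computation: the subtree that is still to be executed (`none` after the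
update at a leaf) and the current D-values. -/
abbrev Config (n : ℕ) : Type := Option (DecisionTree n) × (Fin n → ℤ)

/-- One step (query or update) of a computation on the weights `ℓ`. -/
def Config.step {n : ℕ} (ℓ : Weight n) : Config n → Config n
  | (none, D) => (none, D)
  | (some (.leaf e), D) => (none, relaxD ℓ D e)
  | (some (.relax e A), D) => (some A, relaxD ℓ D e)
  | (some (.query e A B), D) => (some (if D e.src + ℓ e < D e.dst then A else B), D)

/-- The edge that is queried or relaxed at the root of the remaining tree. -/
def rootEdge {n : ℕ} : Option (DecisionTree n) → Option (Edge n)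
  | none => none
  | some (.leaf e) => some e
  | some (.relax e _) => some e
  | some (.query e _ _) => some e

/-- The configuration after `t` steps of `A` on the weights `ℓ`. -/
def DecisionTree.config {n : ℕ} (A : DecisionTree n) (ℓ : Weight n) (s : Fin n) (t : ℕ) :
    Config n :=
  (Config.step ℓ)^[t] (some A, initD ℓ s)

theorem step_iterate_none (ℓ : Weight n) (D : Fin n → ℤ) (t : ℕ) :
    (Config.step ℓ)^[t] (none, D) = (none, D) := by
  induction t with
  | zero => rfl
  | succ t ih => rw [Function.iterate_succ_apply]; exact ih

theorem DecisionTree.run_eq_iterate (ℓ : Weight n) (A : DecisionTree n) (D : Fin n → ℤ) (t : ℕ) :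
    A.run ℓ D t = ((Config.step ℓ)^[t] (some A, D)).2 := by
  induction t generalizing A D with
  | zero => cases A <;> rfl
  | succ t ih =>
    rw [Function.iterate_succ_apply]
    cases A with
    | leaf e => simp [DecisionTree.run, Config.step, step_iterate_none]
    | relax e A => simp [DecisionTree.run, Config.step, ih]
    | query e A B =>
      simp only [DecisionTree.run, Config.step]
      split_ifs <;> simp [ih]

theorem DecisionTree.run_eq_config (ℓ : Weight n) (A : DecisionTree n) (s : Fin n) (t : ℕ) :
    A.run ℓ (initD ℓ s) t = (A.config ℓ s t).2 :=
  A.run_eq_iterate ℓ _ t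

theorem DecisionTree.config_succ (ℓ : Weight n) (A : DecisionTree n) (s : Fin n) (t : ℕ) :
    A.config ℓ s (t + 1) = (A.config ℓ s t).step ℓ :=
  Function.iterate_succ_apply' _ _ _

theorem relaxD_le (ℓ : Weight n) (D : Fin n → ℤ) (e : Edge n) (v : Fin n) :
    relaxD ℓ D e v ≤ D v := by
  unfold relaxD
  by_cases h : v = e.dst
  · subst h; simp
  · simp [Function.update_of_ne h]

theorem relaxD_dst (ℓ : Weight n) (D : Fin n → ℤ) (e : Edge n) :
    relaxD ℓ D e e.dst = min (D e.dst) (D e.src + ℓ e) := by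
  simp [relaxD]

theorem relaxD_of_ne (ℓ : Weight n) (D : Fin n → ℤ) (e : Edge n) {v : Fin n} (h : v ≠ e.dst) :
    relaxD ℓ D e v = D v := by
  simp [relaxD, Function.update_of_ne h]

theorem relaxD_eq_self (ℓ : Weight n) (D : Fin n → ℤ) (e : Edge n)
    (h : D e.dst ≤ D e.src + ℓ e) : relaxD ℓ D e = D := by
  funext v
  by_cases hv : v = e.dst
  · subst hv; rw [relaxD_dst, min_eq_left h]
  · exact relaxD_of_ne ℓ D e hv

/-- Each step leaves the D-values alone or relaxes one edge. -/
theorem step_snd_induction {ℓ : Weight n} {P : (Fin n → ℤ) → Prop}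
    (hP : ∀ D, P D → ∀ e, P (relaxD ℓ D e)) (x : Config n) (hx : P x.2) : P (x.step ℓ).2 := by
  obtain ⟨_ | (e | ⟨e, A⟩ | ⟨e, A, B⟩), D⟩ := x
  · exact hx
  · exact hP D hx e
  · exact hP D hx e
  · exact hx

theorem DecisionTree.config_induction {ℓ : Weight n} {s : Fin n} {P : (Fin n → ℤ) → Prop}
    (h₀ : P (initD ℓ s)) (hP : ∀ D, P D → ∀ e, P (relaxD ℓ D e)) (A : DecisionTree n) (t : ℕ) :
    P (A.config ℓ s t).2 := by
  induction t with
  | zero => exact h₀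
  | succ t ih => rw [config_succ]; exact step_snd_induction hP _ ih

theorem DecisionTree.config_antitone (ℓ : Weight n) (A : DecisionTree n) (s : Fin n) (v : Fin n) :
    Antitone fun t => (A.config ℓ s t).2 v := by
  refine antitone_nat_of_succ_le fun t => ?_
  rw [config_succ]
  exact step_snd_induction (P := fun D => D v ≤ (A.config ℓ s t).2 v)
    (fun D hD e => (relaxD_le ℓ D e v).trans hD) _ le_rfl

/-- If two computations are about to execute the same tree, the edge at its root gets the same
answer in both, and the relation `R` between the D-values survives the relaxation of that edge,
then they are again about to execute the same tree, with `R`-related D-values. -/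
theorem step_agree {ℓ ℓ' : Weight n} {R : (Fin n → ℤ) → (Fin n → ℤ) → Prop} (x x' : Config n)
    (h₁ : x.1 = x'.1) (hR : R x.2 x'.2)
    (h : ∀ e, rootEdge x.1 = some e →
      ((x.2 e.src + ℓ e < x.2 e.dst ↔ x'.2 e.src + ℓ' e < x'.2 e.dst) ∧
        R (relaxD ℓ x.2 e) (relaxD ℓ' x'.2 e))) :
    (x.step ℓ).1 = (x'.step ℓ').1 ∧ R (x.step ℓ).2 (x'.step ℓ').2 := by
  obtain ⟨T, D⟩ := x
  obtain ⟨T', D'⟩ := x'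
  obtain rfl : T = T' := h₁
  obtain _ | (e | ⟨e, A⟩ | ⟨e, A, B⟩) := T
  · exact ⟨rfl, hR⟩
  · exact ⟨rfl, (h e rfl).2⟩
  · exact ⟨rfl, (h e rfl).2⟩
  · refine ⟨?_, hR⟩
    simp only [Config.step]
    rw [if_congr (h e rfl).1 rfl rfl]

/-! ### Distances -/

/-- Distances with respect to simple paths and non-negative weights satisfy the triangle
inequality. -/
theorem CorrectD.le_add {ℓ : Weight n} {s : Fin n} {D : Fin n → ℤ} (hℓ : ∀ e, 0 ≤ ℓ e)
    (hD : CorrectD ℓ s D) (e : Edge n) : D e.dst ≤ D e.src + ℓ e := by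
  obtain ⟨⟨p, hp⟩, -⟩ := hD e.src
  have hmin := (hD e.dst).2
  rw [← hp]
  by_cases hv : e.dst ∈ (p : (⊤ : SimpleGraph (Fin n)).Walk s e.src).support
  · -- A path through the head of `e` already contains a path to it.
    have h1 := hmin ⟨⟨p.1.takeUntil _ hv, p.2.takeUntil hv⟩, rfl⟩
    refine h1.trans ?_
    have h2 : pathLength ℓ p = pathLength ℓ ⟨p.1.takeUntil _ hv, p.2.takeUntil hv⟩ +
        ((p.1.dropUntil _ hv).darts.map fun d => ℓ ⟨d.toProd, d.adj.ne⟩).sum := by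
      unfold pathLength
      conv_lhs => rw [← SimpleGraph.Walk.take_spec p.1 hv]
      rw [SimpleGraph.Walk.darts_append, List.map_append, List.sum_append]
    have h3 : 0 ≤ ((p.1.dropUntil _ hv).darts.map fun d => ℓ ⟨d.toProd, d.adj.ne⟩).sum := by
      apply List.sum_nonneg
      simp only [List.mem_map]
      rintro _ ⟨d, -, rfl⟩
      exact hℓ _
    have := hℓ e
    simp only at *
    linarith
  · have h1 := hmin ⟨⟨p.1.concat (show (⊤ : SimpleGraph (Fin n)).Adj e.src e.dst from e.2),
      p.2.concat hv _⟩, rfl⟩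
    refine h1.trans (le_of_eq ?_)
    simp [pathLength, SimpleGraph.Walk.darts_concat]

theorem CorrectD.start_le {ℓ : Weight n} {s : Fin n} {D : Fin n → ℤ}
    (hD : CorrectD ℓ s D) : D s ≤ 0 :=
  (hD s).2 ⟨SimpleGraph.Path.nil, by simp [pathLength]⟩

/-! ### The hard weight assignments -/

/-- The role of a vertex in a hard instance. The shortest path through the non-free vertices is
`exit 0, entry 0, exit 1, entry 1, exit 2, …`, starting at the start vertex `exit 0`. -/
inductive Role : Type
  | exit (j : ℕ) : Role
  | entry (j : ℕ) : Role
  | free : Role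

/-- Weight of the edge between vertices with given roles. The edges of the hidden path have weight
`g`. The other edges from `exit i` to free or later vertices are such that relaxing them when
`exit i` has its final value `2 * g * i` gives the value `X - 1 - i`. All remaining edges have the
prohibitive weight `X`. -/
def roleWeight (g X : ℤ) : Role → Role → ℤ
  | .exit i, .exit j => X - 1 - (min i j : ℕ) * (2 * g + 1)
  | .exit i, .entry j =>
      if i = j ∨ i = j + 1 then g else if i < j then X - 1 - i * (2 * g + 1) else X
  | .entry j, .exit i =>
      if i = j ∨ i = j + 1 then g else if i < j then X - 1 - i * (2 * g + 1) else X
  | .exit i, .free => X - 1 - i * (2 * g + 1)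
  | .free, .exit i => X - 1 - i * (2 * g + 1)
  | .entry _, .entry _ => X
  | .entry _, .free => X
  | .free, .entry _ => X
  | .free, .free => X

theorem roleWeight_comm (g X : ℤ) (a b : Role) : roleWeight g X a b = roleWeight g X b a := by
  cases a <;> cases b <;> simp [roleWeight, min_comm]

/-- The weight assignment in which each vertex has the role that `ρ` gives it. -/
def layoutWeight (g X : ℤ) (ρ : Fin n → Role) : Weight n :=
  fun e => roleWeight g X (ρ e.src) (ρ e.dst)

/-- `ρ` lays out a hidden path with `k` edges from `entry` to `exit` vertices: the roles
`exit 0 = s, entry 0, …, entry (k - 1), exit k` are each taken by one vertex, and the other vertices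
are free. -/
structure IsLayout (s : Fin n) (k : ℕ) (ρ : Fin n → Role) : Prop where
  start : ρ s = .exit 0
  exit_le : ∀ v j, ρ v = .exit j → j ≤ k
  entry_lt : ∀ v j, ρ v = .entry j → j < k
  exists_exit : ∀ j ≤ k, ∃ v, ρ v = .exit j
  exists_entry : ∀ j < k, ∃ v, ρ v = .entry j
  inj : ∀ u v, ρ u = ρ v → ρ u ≠ .free → u = v

/-- What is true of the D-values at every time of every computation on a layout with `k` pairs. An
`exit` or `entry` vertex with index `j` either has its final value or has been lowered at most by
the exits before it, and the final values are attained in the order of the hidden path. -/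
structure Invariant (g X : ℤ) (k : ℕ) (ρ : Fin n → Role) (D : Fin n → ℤ) : Prop where
  exit : ∀ v j, ρ v = .exit j → D v = 2 * g * j ∨ (X - j ≤ D v ∧ D v ≤ X - 1)
  entry : ∀ v j, ρ v = .entry j → D v = 2 * g * j + g ∨ (X - j ≤ D v ∧ D v ≤ X - 1)
  free : ∀ v, ρ v = .free → X - 1 - k ≤ D v ∧ D v ≤ X - 1
  entry_final : ∀ u v j, ρ u = .exit (j + 1) → ρ v = .entry j → D u = 2 * g * (j + 1) →
    D v = 2 * g * j + g
  exit_final : ∀ u v j, ρ u = .entry j → ρ v = .exit j → D u = 2 * g * j + g → D v = 2 * g * j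
  last_final : ∀ u v, ρ u = .free → ρ v = .exit k → D u = X - 1 - k → D v = 2 * g * k

section
variable {g X : ℤ} {k : ℕ} {s : Fin n} {ρ : Fin n → Role} {D : Fin n → ℤ}

theorem index_mul_le (hg : 1 ≤ g) {i k : ℕ} (h : i ≤ k) : (i : ℤ) * g ≤ k * g ∧ 0 ≤ (i : ℤ) * g :=
  ⟨mul_le_mul_of_nonneg_right (by exact_mod_cast h) (by linarith), by positivity⟩

theorem index_mul_lt (hg : 1 ≤ g) {i k : ℕ} (h : i < k) : (i : ℤ) * g + g ≤ k * g := by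
  have := (index_mul_le hg (Nat.succ_le_of_lt h)).1
  push_cast at this
  linarith

theorem IsLayout.layoutWeight_mem (hρ : IsLayout s k ρ) {M : ℕ} (hg : 1 ≤ g)
    (hX : (k + 2) * (2 * g + 4) ≤ X) (hM : X ≤ M) : layoutWeight g X ρ ∈ nonnegSymm n M := by
  intro e
  have key : 0 ≤ layoutWeight g X ρ e ∧ layoutWeight g X ρ e ≤ X := by
    have hk := (index_mul_le hg (Nat.zero_le k)).1
    have b : ∀ i : ℕ, i ≤ k → 0 ≤ X - 1 - i * (2 * g + 1) ∧ X - 1 - i * (2 * g + 1) ≤ X := by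
      intro i hi
      have h1 := index_mul_le hg hi
      have h2 : (i : ℤ) ≤ k := by exact_mod_cast hi
      constructor <;> linarith
    have h0 : 0 ≤ X := by push_cast at hk; nlinarith
    have hgX : g ≤ X := by push_cast at hk; nlinarith
    unfold layoutWeight
    cases hu : ρ e.src with
    | exit i =>
      have hi := hρ.exit_le _ _ hu
      cases hv : ρ e.dst with
      | exit j => exact b _ (min_le_of_left_le hi)
      | entry j =>
        simp only [roleWeight]
        split_ifs
        · constructor <;> linarith
        · exact b _ hi
        · constructor <;> linarith
      | free => exact b _ hi
    | entry j =>
      cases hv : ρ e.dst with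
      | exit i =>
        have hi := hρ.exit_le _ _ hv
        simp only [roleWeight]
        split_ifs
        · constructor <;> linarith
        · exact b _ hi
        · constructor <;> linarith
      | entry j => exact ⟨h0, le_rfl⟩
      | free => exact ⟨h0, le_rfl⟩
    | free =>
      cases hv : ρ e.dst with
      | exit i => exact b _ (hρ.exit_le _ _ hv)
      | entry j => exact ⟨h0, le_rfl⟩
      | free => exact ⟨h0, le_rfl⟩
  exact ⟨key.1, key.2.trans hM, roleWeight_comm _ _ _ _⟩

theorem Invariant.init (hρ : IsLayout s k ρ) (hg : 1 ≤ g) (hX : (k + 2) * (2 * g + 4) ≤ X) :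
    Invariant g X k ρ (initD (layoutWeight g X ρ) s) := by
  have hs : initD (layoutWeight g X ρ) s s = 0 := by simp [initD]
  have hv : ∀ v, s ≠ v → initD (layoutWeight g X ρ) s v = roleWeight g X (.exit 0) (ρ v) := by
    intro v h
    simp [initD, h, layoutWeight, hρ.start]
  have h0 : ∀ v, ρ v = .exit 0 → v = s := fun v h =>
    hρ.inj v s (h.trans hρ.start.symm) (by simp [h])
  have hne : ∀ v, ρ v ≠ .exit 0 → s ≠ v := by
    rintro v h rfl
    exact h hρ.start
  have hexit : ∀ v j, ρ v = .exit (j + 1) → initD (layoutWeight g X ρ) s v = X - 1 := by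
    intro v j h
    rw [hv v (hne v (by simp [h])), h]
    simp [roleWeight]
  have hentry : ∀ v j, ρ v = .entry (j + 1) → initD (layoutWeight g X ρ) s v = X - 1 := by
    intro v j h
    rw [hv v (hne v (by simp [h])), h]
    simp [roleWeight]
  have hfree : ∀ v, ρ v = .free → initD (layoutWeight g X ρ) s v = X - 1 := by
    intro v h
    rw [hv v (hne v (by simp [h])), h]
    simp [roleWeight]
  have hk := (index_mul_le hg le_rfl : (k : ℤ) * g ≤ k * g ∧ _).2
  have hlarge : ∀ j : ℕ, j ≤ k → 2 * g * j + g < X - 1 := by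
    intro j hj
    have h1 := index_mul_le hg hj
    linarith
  constructor
  · rintro v (_ | j) h
    · rw [h0 v h, hs]; simp
    · rw [hexit v j h]; right; push_cast; constructor <;> linarith
  · rintro v (_ | j) h
    · rw [hv v (hne v (by simp [h])), h]; simp [roleWeight]
    · rw [hentry v j h]; right; push_cast; constructor <;> linarith
  · intro v h
    rw [hfree v h]
    constructor <;> linarith
  · intro u v j hu _ h
    rw [hexit u j hu] at h
    have := hlarge (j + 1) (hρ.exit_le _ _ hu)
    push_cast at this
    linarith
  · rintro u v (_ | j) hu hv' h
    · rw [h0 v hv', hs]; simp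
    · rw [hentry u j hu] at h
      linarith [hlarge (j + 1) (hρ.entry_lt _ _ hu).le]
  · intro u v hu hv' h
    rw [hfree u hu] at h
    obtain rfl : k = 0 := by
      have : (k : ℤ) = 0 := by linarith
      exact_mod_cast this
    rw [h0 v hv', hs]; simp

theorem Invariant.exit_bounds (hρ : IsLayout s k ρ) (hg : 1 ≤ g) (hX : (k + 2) * (2 * g + 4) ≤ X)
    (h : Invariant g X k ρ D) {v : Fin n} {j : ℕ} (hv : ρ v = .exit j) :
    2 * g * j ≤ D v ∧ D v ≤ X - 1 := by
  have hj := hρ.exit_le _ _ hv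
  have h1 := index_mul_le hg hj
  have h2 : (j : ℤ) ≤ k := by exact_mod_cast hj
  rcases h.exit v j hv with h3 | h3 <;> constructor <;> linarith

theorem Invariant.entry_bounds (hρ : IsLayout s k ρ) (hg : 1 ≤ g)
    (hX : (k + 2) * (2 * g + 4) ≤ X)
    (h : Invariant g X k ρ D) {v : Fin n} {j : ℕ} (hv : ρ v = .entry j) :
    2 * g * j + g ≤ D v ∧ D v ≤ X - 1 := by
  have hj := (hρ.entry_lt _ _ hv).le
  have h1 := index_mul_le hg hj
  have h2 : (j : ℤ) ≤ k := by exact_mod_cast hj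
  rcases h.entry v j hv with h3 | h3 <;> constructor <;> linarith

theorem Invariant.bounds (hρ : IsLayout s k ρ) (hg : 1 ≤ g)
    (hX : (k + 2) * (2 * g + 4) ≤ X)
    (h : Invariant g X k ρ D) (v : Fin n) : 0 ≤ D v ∧ D v ≤ X - 1 := by
  have h0 := (index_mul_le hg le_rfl : (k : ℤ) * g ≤ k * g ∧ _).2
  cases hv : ρ v with
  | exit j =>
    have := h.exit_bounds hρ hg hX hv
    have := (index_mul_le hg (hρ.exit_le _ _ hv)).2
    constructor <;> linarith
  | entry j =>
    have := h.entry_bounds hρ hg hX hv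
    have := (index_mul_le hg (hρ.entry_lt _ _ hv).le).2
    constructor <;> linarith
  | free =>
    have := h.free v hv
    constructor <;> linarith

/-- The value that relaxing an edge offers to an `exit` vertex. -/
theorem Invariant.offer_exit (hρ : IsLayout s k ρ) (hg : 1 ≤ g) (hX : (k + 2) * (2 * g + 4) ≤ X)
    (h : Invariant g X k ρ D) {u v : Fin n} {j : ℕ} (huv : u ≠ v) (hv : ρ v = .exit j) :
    D v ≤ D u + roleWeight g X (ρ u) (ρ v) ∨ X - j ≤ D u + roleWeight g X (ρ u) (ρ v) ∨
      (D u + roleWeight g X (ρ u) (ρ v) = 2 * g * j ∧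
        ∃ i, j = i + 1 ∧ ρ u = .entry i ∧ D u = 2 * g * i + g) := by
  have hDv := (h.exit_bounds hρ hg hX hv).2
  have hj := hρ.exit_le _ _ hv
  have hj1 := index_mul_le hg hj
  have hj2 : (j : ℤ) ≤ k := by exact_mod_cast hj
  cases hu : ρ u with
  | exit i =>
    have hi := hρ.exit_le _ _ hu
    have hi1 := index_mul_le hg hi
    have hi2 : (i : ℤ) ≤ k := by exact_mod_cast hi
    have hij : i ≠ j := fun hij => huv (hρ.inj u v (by rw [hu, hv, hij]) (by simp [hu]))
    rw [hv]
    simp only [roleWeight]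
    rcases lt_or_gt_of_ne hij with hij | hij
    · rw [min_eq_left hij.le]
      have : (i : ℤ) + 1 ≤ j := by exact_mod_cast hij
      rcases h.exit u i hu with h3 | h3
      · right; left; linarith
      · left; linarith
    · rw [min_eq_right hij.le]
      have := index_mul_lt hg hij
      have := h.exit_bounds hρ hg hX hu
      right; left; linarith
  | entry i =>
    have hi := (hρ.entry_lt _ _ hu).le
    have hi1 := index_mul_le hg hi
    have hi2 : (i : ℤ) ≤ k := by exact_mod_cast hi
    have hDu := h.entry_bounds hρ hg hX hu
    rw [hv]
    simp only [roleWeight]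
    split_ifs with h3 h4
    · rcases h3 with rfl | rfl
      · rcases h.entry u j hu with h4 | h4
        · left; rw [h.exit_final u v j hu hv h4]; linarith
        · right; left; linarith
      · rcases h.entry u i hu with h4 | h4
        · right; right
          exact ⟨by push_cast; linarith, i, rfl, rfl, h4⟩
        · right; left; push_cast; linarith
    · have := index_mul_le hg h4.le
      right; left; linarith
    · left; linarith
  | free =>
    have := h.free u hu
    rw [hv]
    simp only [roleWeight]
    left; linarith

/-- The value that relaxing an edge offers to an `entry` vertex. -/
theorem Invariant.offer_entry (hρ : IsLayout s k ρ) (hg : 1 ≤ g) (hX : (k + 2) * (2 * g + 4) ≤ X)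
    (h : Invariant g X k ρ D) {u v : Fin n} {j : ℕ} (hv : ρ v = .entry j) :
    D v ≤ D u + roleWeight g X (ρ u) (ρ v) ∨ X - j ≤ D u + roleWeight g X (ρ u) (ρ v) ∨
      (D u + roleWeight g X (ρ u) (ρ v) = 2 * g * j + g ∧ ρ u = .exit j ∧ D u = 2 * g * j) := by
  have hDv := (h.entry_bounds hρ hg hX hv).2
  have hDu0 := (h.bounds hρ hg hX u).1
  have hj := (hρ.entry_lt _ _ hv).le
  have hj1 := index_mul_le hg hj
  have hj2 : (j : ℤ) ≤ k := by exact_mod_cast hj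
  cases hu : ρ u with
  | exit i =>
    have hi := hρ.exit_le _ _ hu
    have hi1 := index_mul_le hg hi
    have hi2 : (i : ℤ) ≤ k := by exact_mod_cast hi
    rw [hv]
    simp only [roleWeight]
    split_ifs with h3 h4
    · rcases h3 with rfl | rfl
      · rcases h.exit u i hu with h4 | h4
        · right; right; exact ⟨by linarith, rfl, h4⟩
        · right; left; linarith
      · rcases h.exit u (j + 1) hu with h4 | h4
        · push_cast at h4
          left; rw [h.entry_final u v j hu hv h4]; linarith
        · push_cast at h4
          right; left; linarith
    · have : (i : ℤ) + 1 ≤ j := by exact_mod_cast h4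
      rcases h.exit u i hu with h3 | h3
      · right; left; linarith
      · left; linarith
    · left; linarith
  | entry i =>
    rw [hv]
    simp only [roleWeight]
    left; linarith
  | free =>
    rw [hv]
    simp only [roleWeight]
    left; linarith

/-- The value that relaxing an edge offers to a free vertex. -/
theorem Invariant.offer_free (hρ : IsLayout s k ρ) (hg : 1 ≤ g) (hX : (k + 2) * (2 * g + 4) ≤ X)
    (h : Invariant g X k ρ D) {u v : Fin n} (hv : ρ v = .free) :
    D v ≤ D u + roleWeight g X (ρ u) (ρ v) ∨ X - 1 - k < D u + roleWeight g X (ρ u) (ρ v) ∨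
      (D u + roleWeight g X (ρ u) (ρ v) = X - 1 - k ∧ ρ u = .exit k ∧ D u = 2 * g * k) := by
  have hDv := (h.free v hv).2
  have hDu0 := (h.bounds hρ hg hX u).1
  have hk := (index_mul_le hg le_rfl : (k : ℤ) * g ≤ k * g ∧ _).2
  cases hu : ρ u with
  | exit i =>
    have hi := hρ.exit_le _ _ hu
    have hi1 := index_mul_le hg hi
    have hi2 : (i : ℤ) ≤ k := by exact_mod_cast hi
    rw [hv]
    simp only [roleWeight]
    rcases h.exit u i hu with h3 | h3
    · right
      rcases hi.lt_or_eq with h4 | rfl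
      · have : (i : ℤ) + 1 ≤ k := by exact_mod_cast h4
        left; linarith
      · right; exact ⟨by linarith, rfl, h3⟩
    · left; linarith
  | entry i =>
    rw [hv]
    simp only [roleWeight]
    left; linarith
  | free =>
    rw [hv]
    simp only [roleWeight]
    left; linarith

theorem Invariant.relax (hρ : IsLayout s k ρ) (hg : 1 ≤ g) (hX : (k + 2) * (2 * g + 4) ≤ X)
    (h : Invariant g X k ρ D) (e : Edge n) :
    Invariant g X k ρ (relaxD (layoutWeight g X ρ) D e) := by
  by_cases hno : D e.dst ≤ D e.src + layoutWeight g X ρ e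
  · rwa [relaxD_eq_self _ _ _ hno]
  push Not at hno
  have hk := (index_mul_le hg le_rfl : (k : ℤ) * g ≤ k * g ∧ _).2
  have hlarge : ∀ j : ℕ, j ≤ k → 2 * g * j + g < X - 1 - k := by
    intro j hj
    have h1 := index_mul_le hg hj
    linarith
  have hcast : ∀ {i j : ℕ}, i ≤ j → (i : ℤ) ≤ j := fun h => by exact_mod_cast h
  set D' := relaxD (layoutWeight g X ρ) D e with hD'
  have hdst : D' e.dst = D e.src + layoutWeight g X ρ e := by
    rw [hD', relaxD_dst, min_eq_right hno.le]
  have hoth : ∀ v, v ≠ e.dst → D' v = D v := fun v hv => relaxD_of_ne _ _ _ hv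
  have hsrc : D' e.src = D e.src := hoth _ e.2
  have hexit : ∀ v j, ρ v = .exit j →
      D' v = D v ∨ (X - j ≤ D' v ∧ D' v ≤ X - 1) ∨ (D' v = 2 * g * j ∧
        ∃ i u, j = i + 1 ∧ ρ u = .entry i ∧ D u = 2 * g * i + g) := by
    intro v j hv
    by_cases hve : v = e.dst
    · subst hve
      right
      rw [hdst]
      have hb := (h.exit_bounds hρ hg hX hv).2
      rcases h.offer_exit hρ hg hX e.2 hv with h1 | h1 | ⟨h1, i, h2⟩
      · exact absurd hno (not_lt.2 h1)
      · exact Or.inl ⟨h1, (hno.le.trans hb)⟩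
      · exact Or.inr ⟨h1, i, e.src, h2⟩
    · exact Or.inl (hoth v hve)
  have hentry : ∀ v j, ρ v = .entry j →
      D' v = D v ∨ (X - j ≤ D' v ∧ D' v ≤ X - 1) ∨ (D' v = 2 * g * j + g ∧
        ∃ u, ρ u = .exit j ∧ D u = 2 * g * j) := by
    intro v j hv
    by_cases hve : v = e.dst
    · subst hve
      right
      rw [hdst]
      have hb := (h.entry_bounds hρ hg hX hv).2
      rcases h.offer_entry hρ hg hX hv with h1 | h1 | ⟨h1, h2⟩
      · exact absurd hno (not_lt.2 h1)
      · exact Or.inl ⟨h1, (hno.le.trans hb)⟩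
      · exact Or.inr ⟨h1, e.src, h2⟩
    · exact Or.inl (hoth v hve)
  have hfree : ∀ v, ρ v = .free →
      D' v = D v ∨ (X - 1 - k < D' v ∧ D' v ≤ X - 1) ∨ (D' v = X - 1 - k ∧
        ∃ u, ρ u = .exit k ∧ D u = 2 * g * k) := by
    intro v hv
    by_cases hve : v = e.dst
    · subst hve
      right
      rw [hdst]
      have hb := (h.free _ hv).2
      rcases h.offer_free hρ hg hX hv with h1 | h1 | ⟨h1, h2⟩
      · exact absurd hno (not_lt.2 h1)
      · exact Or.inl ⟨h1, (hno.le.trans hb)⟩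
      · exact Or.inr ⟨h1, e.src, h2⟩
    · exact Or.inl (hoth v hve)
  have hle : ∀ v, D' v ≤ D v := relaxD_le _ _ _
  -- Final values stay: they are the least values that a vertex can have.
  have hexit_stay : ∀ v j, ρ v = .exit j → D v = 2 * g * j → D' v = 2 * g * j := by
    intro v j hv h1
    rcases hexit v j hv with h2 | h2 | h2
    · rw [h2, h1]
    · have := hlarge j (hρ.exit_le _ _ hv)
      have := hcast (hρ.exit_le _ _ hv)
      have := hle v
      linarith
    · exact h2.1
  have hentry_stay : ∀ v j, ρ v = .entry j → D v = 2 * g * j + g → D' v = 2 * g * j + g := by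
    intro v j hv h1
    rcases hentry v j hv with h2 | h2 | h2
    · rw [h2, h1]
    · have := hlarge j (hρ.entry_lt _ _ hv).le
      have := hcast (hρ.entry_lt _ _ hv).le
      have := hle v
      linarith
    · exact h2.1
  have huniq : ∀ {u v : Fin n} {r : Role}, ρ u = r → ρ v = r → r ≠ .free → u = v :=
    fun hu hv hr => hρ.inj _ _ (hu.trans hv.symm) (hu ▸ hr)
  constructor
  · intro v j hv
    rcases hexit v j hv with h1 | h1 | h1
    · rw [h1]; exact h.exit v j hv
    · exact Or.inr h1
    · exact Or.inl h1.1
  · intro v j hv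
    rcases hentry v j hv with h1 | h1 | h1
    · rw [h1]; exact h.entry v j hv
    · exact Or.inr h1
    · exact Or.inl h1.1
  · intro v hv
    rcases hfree v hv with h1 | h1 | h1
    · rw [h1]; exact h.free v hv
    · exact ⟨h1.1.le, h1.2⟩
    · exact ⟨h1.1.ge, by linarith [h1.1]⟩
  · intro u v j hu hv hfin
    apply hentry_stay v j hv
    rcases hexit u _ hu with h1 | h1 | ⟨-, i, w, hi, hw, h1⟩
    · exact h.entry_final u v j hu hv (h1 ▸ hfin)
    · have h2 := hlarge (j + 1) (hρ.exit_le _ _ hu)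
      have h3 := hcast (hρ.exit_le _ _ hu)
      push_cast at h1 h2 h3
      linarith
    · obtain rfl : j = i := by simpa using hi
      rw [huniq hv hw (by simp)]
      exact h1
  · intro u v j hu hv hfin
    apply hexit_stay v j hv
    rcases hentry u _ hu with h1 | h1 | ⟨-, w, hw, h1⟩
    · exact h.exit_final u v j hu hv (h1 ▸ hfin)
    · have h2 := hlarge j (hρ.entry_lt _ _ hu).le
      have h3 := hcast (hρ.entry_lt _ _ hu).le
      linarith
    · rw [huniq hv hw (by simp)]
      exact h1
  · intro u v hu hv hfin
    apply hexit_stay v k hv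
    rcases hfree u hu with h1 | h1 | ⟨-, w, hw, h1⟩
    · exact h.last_final u v hu hv (h1 ▸ hfin)
    · linarith
    · rw [huniq hv hw (by simp)]
      exact h1

theorem Invariant.config (hρ : IsLayout s k ρ) (hg : 1 ≤ g) (hX : (k + 2) * (2 * g + 4) ≤ X)
    (A : DecisionTree n) (t : ℕ) :
    Invariant g X k ρ (A.config (layoutWeight g X ρ) s t).2 :=
  A.config_induction (Invariant.init hρ hg hX) (fun _ h e => h.relax hρ hg hX e) t

/-- Correct D-values are at most the lengths along the hidden path. -/
theorem CorrectD.exit_le (hρ : IsLayout s k ρ) (hnn : ∀ e, 0 ≤ layoutWeight g X ρ e)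
    (hD : CorrectD (layoutWeight g X ρ) s D) {j : ℕ} (hj : j ≤ k) {v : Fin n}
    (hv : ρ v = .exit j) : D v ≤ 2 * g * j := by
  induction j generalizing v with
  | zero =>
    rw [hρ.inj v s (hv.trans hρ.start.symm) (by simp [hv])]
    simpa using hD.start_le
  | succ j ih =>
    obtain ⟨b, hb⟩ := hρ.exists_entry j hj
    obtain ⟨c, hc⟩ := hρ.exists_exit j (by omega)
    have h1 := hD.le_add hnn ⟨(c, b), fun h => by simp_all⟩
    have h2 := hD.le_add hnn ⟨(b, v), fun h => by
      obtain rfl : b = v := h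
      simp [hb] at hv⟩
    have h3 := ih (by omega) hc
    simp [layoutWeight, Edge.src, Edge.dst, hb, hc, hv, roleWeight] at h1 h2
    push_cast
    linarith

end

/-! ### Extending the hidden path -/

/-- The layout `ρ` with the hidden path prolonged from `exit k` through `b` to `c`. -/
def extendLayout (ρ : Fin n → Role) (k : ℕ) (b c : Fin n) : Fin n → Role :=
  Function.update (Function.update ρ b (.entry k)) c (.exit (k + 1))

/-- The free vertices and the last vertex of the hidden path have D-values that are at most `g`
apart, apart from the final value of the last vertex, which may be much lower. Under this condition
no edge of weight `g` between two of them would answer "yes" to a query. -/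
structure Spread (g : ℤ) (k : ℕ) (ρ : Fin n → Role) (D : Fin n → ℤ) : Prop where
  free_free : ∀ x y, ρ x = .free → ρ y = .free → D y ≤ D x + g
  free_last : ∀ x y, ρ x = .free → ρ y = .exit k → D y ≤ D x + g
  last_free : ∀ x y, ρ x = .exit k → ρ y = .free → D x ≠ 2 * g * k → D y ≤ D x + g

/-- The relation between D-values `D` of a computation on a layout and D-values `D'` of the same
computation on the layout that is extended through `b`: they are equal, except that `b` has its
final value in `D'` if it has the lowest possible value `X - 1 - k` in `D`. -/
structure Agree (g X : ℤ) (k : ℕ) (b : Fin n) (D D' : Fin n → ℤ) : Prop where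
  eq : ∀ x, x ≠ b → D' x = D x
  entry : (D b = X - 1 - k ∧ D' b = 2 * g * k + g) ∨ (X - k ≤ D b ∧ D' b = D b)

section
variable {g X : ℤ} {k : ℕ} {s b c : Fin n} {ρ : Fin n → Role} {D D' : Fin n → ℤ}

theorem extendLayout_exit : extendLayout ρ k b c c = .exit (k + 1) := by
  simp [extendLayout]

theorem extendLayout_entry (hbc : b ≠ c) : extendLayout ρ k b c b = .entry k := by
  simp [extendLayout, Function.update_of_ne hbc]

theorem extendLayout_of_ne {x : Fin n} (hb : x ≠ b) (hc : x ≠ c) :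
    extendLayout ρ k b c x = ρ x := by
  simp [extendLayout, Function.update_of_ne hb, Function.update_of_ne hc]

theorem IsLayout.extend (hρ : IsLayout s k ρ) (hb : ρ b = .free) (hc : ρ c = .free)
    (hbc : b ≠ c) : IsLayout s (k + 1) (extendLayout ρ k b c) := by
  have key : ∀ x, (x = b ∧ extendLayout ρ k b c x = .entry k) ∨
      (x = c ∧ extendLayout ρ k b c x = .exit (k + 1)) ∨
      (x ≠ b ∧ x ≠ c ∧ extendLayout ρ k b c x = ρ x) := by
    intro x
    by_cases h1 : x = b
    · left; exact ⟨h1, by rw [h1]; exact extendLayout_entry hbc⟩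
    by_cases h2 : x = c
    · right; left; exact ⟨h2, h2 ▸ extendLayout_exit⟩
    · right; right; exact ⟨h1, h2, extendLayout_of_ne h1 h2⟩
  have hne : ∀ x, ρ x ≠ .free → extendLayout ρ k b c x = ρ x := fun x hx =>
    extendLayout_of_ne (fun h => hx (h ▸ hb)) (fun h => hx (h ▸ hc))
  constructor
  · rw [hne s (by simp [hρ.start]), hρ.start]
  · intro v j hv
    rcases key v with ⟨-, h⟩ | ⟨-, h⟩ | ⟨-, -, h⟩
    · simp [h] at hv
    · simp [h] at hv; omega
    · have := hρ.exit_le v j (h ▸ hv); omega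
  · intro v j hv
    rcases key v with ⟨-, h⟩ | ⟨-, h⟩ | ⟨-, -, h⟩
    · simp [h] at hv; omega
    · simp [h] at hv
    · have := hρ.entry_lt v j (h ▸ hv); omega
  · intro j hj
    rcases hj.lt_or_eq with h | rfl
    · obtain ⟨v, hv⟩ := hρ.exists_exit j (by omega)
      exact ⟨v, by rw [hne v (by simp [hv]), hv]⟩
    · exact ⟨c, extendLayout_exit⟩
  · intro j hj
    rcases (Nat.lt_succ_iff.1 hj).lt_or_eq with h | rfl
    · obtain ⟨v, hv⟩ := hρ.exists_entry j h
      exact ⟨v, by rw [hne v (by simp [hv]), hv]⟩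
    · exact ⟨b, extendLayout_entry hbc⟩
  · intro u v huv hu
    rcases key u with ⟨h1, h⟩ | ⟨h1, h⟩ | ⟨-, -, h⟩ <;>
      rcases key v with ⟨h1', h'⟩ | ⟨h1', h'⟩ | ⟨-, -, h'⟩ <;> rw [h] at huv hu <;> rw [h'] at huv
    · rw [h1, h1']
    · simp at huv
    · exact absurd (hρ.entry_lt v k huv.symm) (lt_irrefl _)
    · simp at huv
    · rw [h1, h1']
    · have := hρ.exit_le v _ huv.symm; omega
    · exact absurd (hρ.entry_lt u k huv) (lt_irrefl _)
    · have := hρ.exit_le u _ huv; omega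
    · exact hρ.inj u v huv hu

/-- The vertices of the hidden path become final in order. -/
theorem Invariant.exit_final_of_last (hρ : IsLayout s k ρ) (h : Invariant g X k ρ D)
    {w : Fin n} (hw : ρ w = .exit k) (hfin : D w = 2 * g * k) {j : ℕ} (hj : j ≤ k) {v : Fin n}
    (hv : ρ v = .exit j) : D v = 2 * g * j := by
  induction hj using Nat.decreasingInduction generalizing v with
  | self => rwa [hρ.inj v w (hv.trans hw.symm) (by simp [hv])]
  | of_succ j hj ih =>
    obtain ⟨u, hu⟩ := hρ.exists_exit (j + 1) hj
    obtain ⟨x, hx⟩ := hρ.exists_entry j hj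
    exact h.exit_final x v j hx hv (h.entry_final u x j hu hx (by simpa using ih hu))

/-- An edge that offers no improvement under `D` nor under `D'` changes nothing. -/
theorem Agree.of_no (hA : Agree g X k b D D') {ℓ ℓ' : Weight n} {e : Edge n}
    (h : D e.dst ≤ D e.src + ℓ e) (h' : D' e.dst ≤ D' e.src + ℓ' e) :
    (D e.src + ℓ e < D e.dst ↔ D' e.src + ℓ' e < D' e.dst) ∧
      Agree g X k b (relaxD ℓ D e) (relaxD ℓ' D' e) := by
  rw [relaxD_eq_self _ _ _ h, relaxD_eq_self _ _ _ h']
  exact ⟨iff_of_false (not_lt.2 h) (not_lt.2 h'), hA⟩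

/-- Edges away from `b` whose weight is the same in both layouts have the same effect. -/
theorem Agree.of_eq (hA : Agree g X k b D D') {ℓ ℓ' : Weight n} {e : Edge n}
    (hs : e.src ≠ b) (hd : e.dst ≠ b) (hℓ : ℓ' e = ℓ e) :
    (D e.src + ℓ e < D e.dst ↔ D' e.src + ℓ' e < D' e.dst) ∧
      Agree g X k b (relaxD ℓ D e) (relaxD ℓ' D' e) := by
  rw [hA.eq _ hs, hA.eq _ hd, hℓ]
  refine ⟨Iff.rfl, fun x hx => ?_, ?_⟩
  · by_cases h : x = e.dst
    · subst h
      rw [relaxD_dst, relaxD_dst, hA.eq _ hs, hA.eq _ hd, hℓ]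
    · rw [relaxD_of_ne _ _ _ h, relaxD_of_ne _ _ _ h, hA.eq _ hx]
  · rw [relaxD_of_ne _ _ _ hd.symm, relaxD_of_ne _ _ _ hd.symm]
    exact hA.entry

/-- Relaxing an edge into `b` can break the relation only at `b`. -/
theorem Agree.of_dst (hA : Agree g X k b D D') {ℓ ℓ' : Weight n} {e : Edge n} (hd : e.dst = b)
    (hq : D e.src + ℓ e < D e.dst ↔ D' e.src + ℓ' e < D' e.dst)
    (hb : (min (D b) (D e.src + ℓ e) = X - 1 - k ∧
        min (D' b) (D' e.src + ℓ' e) = 2 * g * k + g) ∨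
      (X - k ≤ min (D b) (D e.src + ℓ e) ∧
        min (D' b) (D' e.src + ℓ' e) = min (D b) (D e.src + ℓ e))) :
    (D e.src + ℓ e < D e.dst ↔ D' e.src + ℓ' e < D' e.dst) ∧
      Agree g X k b (relaxD ℓ D e) (relaxD ℓ' D' e) := by
  subst hd
  refine ⟨hq, fun x hx => ?_, ?_⟩
  · rw [relaxD_of_ne _ _ _ hx, relaxD_of_ne _ _ _ hx, hA.eq _ hx]
  · rw [relaxD_dst, relaxD_dst]; exact hb

/-- Processing any edge other than the hidden edge `(b, c)` after `exit k` has relaxed `b` does not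
tell the layouts `ρ` and `extendLayout ρ k b c` apart. -/
theorem Agree.relax (hρ : IsLayout s k ρ) (hb : ρ b = .free) (hc : ρ c = .free) (hbc : b ≠ c)
    (hg : 1 ≤ g) (hX : (k + 3) * (2 * g + 4) ≤ X) (hI : Invariant g X k ρ D)
    (hS : Spread g k ρ D) (hA : Agree g X k b D D') (e : Edge n)
    (he : ¬ (e.src = b ∧ e.dst = c ∧ D b ≤ X - 1 - k)) :
    (D e.src + layoutWeight g X ρ e < D e.dst ↔
        D' e.src + layoutWeight g X (extendLayout ρ k b c) e < D' e.dst) ∧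
      Agree g X k b (relaxD (layoutWeight g X ρ) D e)
        (relaxD (layoutWeight g X (extendLayout ρ k b c)) D' e) := by
  have hX' : (k + 2) * (2 * g + 4) ≤ X := by linarith
  have hk := (index_mul_le hg le_rfl : (k : ℤ) * g ≤ k * g ∧ _).2
  have hDb := hI.free b hb
  have hDc := hI.free c hc
  have hD := hI.bounds hρ hg hX'
  have hD'b : 2 * g * k + g ≤ D' b ∧ D' b ≤ X - 1 := by
    rcases hA.entry with h | h
    · rw [h.2]; constructor <;> linarith
    · rw [h.2]; constructor <;> linarith
  have hD' : ∀ x, 0 ≤ D' x ∧ D' x ≤ X - 1 := by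
    intro x
    by_cases hx : x = b
    · subst hx; constructor <;> linarith
    · rw [hA.eq x hx]; exact hD x
  have hroleb : extendLayout ρ k b c b = .entry k := extendLayout_entry hbc
  have hrolec : extendLayout ρ k b c c = .exit (k + 1) := extendLayout_exit
  obtain ⟨⟨u, v⟩, huv⟩ := e
  simp only [Edge.src, Edge.dst] at he huv
  by_cases hvb : v = b
  · subst hvb
    by_cases huc : u = c
    · -- the reverse of the hidden edge
      subst huc
      apply hA.of_no
      · simp only [layoutWeight, Edge.src, Edge.dst, hb, hc, roleWeight]
        linarith [hD u]
      · simp only [layoutWeight, Edge.src, Edge.dst, hroleb, hrolec, roleWeight]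
        rw [hA.eq u huv]
        simp only [or_true, if_true]
        rcases hA.entry with h | h
        · rw [h.2]; linarith
        · rw [h.2]; exact hS.free_free u v hc hb
    · have hroleu : extendLayout ρ k v c u = ρ u := extendLayout_of_ne huv huc
      cases hu : ρ u with
      | exit j =>
        have hj := hρ.exit_le _ _ hu
        have hj1 := index_mul_le hg hj
        have hj2 : (j : ℤ) ≤ k := by exact_mod_cast hj
        rcases hj.lt_or_eq with hjk | rfl
        · -- an earlier exit than the last, whose offer `v` has already got or accepts in both
          have hjk' : (j : ℤ) + 1 ≤ k := by exact_mod_cast hjk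
          have hw : layoutWeight g X ρ ⟨(u, v), huv⟩ = X - 1 - j * (2 * g + 1) := by
            simp [layoutWeight, hu, hb, roleWeight]
          have hw' : layoutWeight g X (extendLayout ρ k v c) ⟨(u, v), huv⟩ =
              X - 1 - j * (2 * g + 1) := by
            simp only [layoutWeight, Edge.src, Edge.dst, hroleu, hroleb, hu, roleWeight]
            rw [if_neg (by omega), if_pos hjk]
          have hoff : X - k ≤ D u + (X - 1 - j * (2 * g + 1)) := by
            linarith [(hI.exit_bounds hρ hg hX' hu).1]
          rcases hA.entry with h | h
          · apply hA.of_no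
            · simp only [hw]; linarith
            · simp only [hw', hA.eq u huv]; linarith
          · apply hA.of_dst rfl
            · simp only [hw, hw', hA.eq u huv, h.2]
            · right
              simp only [hw, hw', hA.eq u huv, h.2, le_min_iff]
              exact ⟨⟨h.1, hoff⟩, trivial⟩
        · -- the last exit
          have hw : layoutWeight g X ρ ⟨(u, v), huv⟩ = X - 1 - j * (2 * g + 1) := by
            simp [layoutWeight, hu, hb, roleWeight]
          have hw' : layoutWeight g X (extendLayout ρ j v c) ⟨(u, v), huv⟩ = g := by
            simp [layoutWeight, hroleu, hroleb, hu, roleWeight]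
          by_cases hfin : D u = 2 * g * j
          · apply hA.of_dst rfl
            · simp only [hw, hw', hA.eq u huv, hfin]
              rcases hA.entry with h | h
              · rw [h.1, h.2]; constructor <;> intro <;> linarith
              · rw [h.2]; constructor <;> intro <;> linarith
            · left
              simp only [hw, hw', hA.eq u huv, hfin]
              rw [min_eq_right (by linarith), min_eq_right (by linarith)]
              exact ⟨by ring, rfl⟩
          · rcases hI.exit u j hu with h1 | h1
            · exact absurd h1 hfin
            apply hA.of_no
            · simp only [hw]; linarith
            · simp only [hw', hA.eq u huv]
              rcases hA.entry with h | h
              · exact absurd (hI.last_final v u hb hu h.1) hfin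
              · rw [h.2]; exact hS.last_free u v hu hb hfin
      | entry j =>
        apply hA.of_no
        · simp only [layoutWeight, Edge.src, Edge.dst, hb, hu, roleWeight]
          linarith [hD u]
        · simp only [layoutWeight, Edge.src, Edge.dst, hroleb, hroleu, hu, roleWeight]
          linarith [hD' u]
      | free =>
        apply hA.of_no
        · simp only [layoutWeight, Edge.src, Edge.dst, hb, hu, roleWeight]
          linarith [hD u]
        · simp only [layoutWeight, Edge.src, Edge.dst, hroleb, hroleu, hu, roleWeight]
          linarith [hD' u]
  by_cases hub : u = b
  · subst hub
    by_cases hvc : v = c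
    · -- the hidden edge, before the last exit has relaxed `b`
      subst hvc
      have h1 : ¬ D u ≤ X - 1 - k := fun h => he ⟨rfl, rfl, h⟩
      apply hA.of_no
      · simp only [layoutWeight, Edge.src, Edge.dst, hb, hc, roleWeight]
        linarith [hD u]
      · simp only [layoutWeight, Edge.src, Edge.dst, hroleb, hrolec, roleWeight]
        rw [hA.eq v hvb]
        simp only [or_true, if_true]
        rcases hA.entry with h | h
        · exact absurd h.1.le h1
        · rw [h.2]; exact hS.free_free u v hb hc
    · have hrolev : extendLayout ρ k u c v = ρ v := extendLayout_of_ne hvb hvc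
      cases hv : ρ v with
      | exit j =>
        have hj := hρ.exit_le _ _ hv
        have hj1 := index_mul_le hg hj
        have hj2 : (j : ℤ) ≤ k := by exact_mod_cast hj
        apply hA.of_no
        · simp only [layoutWeight, Edge.src, Edge.dst, hb, hv, roleWeight]
          linarith [hD v]
        · simp only [layoutWeight, Edge.src, Edge.dst, hrolev, hroleb, hv]
          rw [hA.eq v hvb]
          rcases hA.entry with h | h
          · -- here all exits up to the last are final
            obtain ⟨w, hw⟩ := hρ.exists_exit k le_rfl
            rw [h.2, hI.exit_final_of_last hρ hw (hI.last_final u w hb hw h.1) hj hv]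
            simp only [roleWeight]
            split_ifs <;> linarith
          · rw [h.2]
            simp only [roleWeight]
            split_ifs with h1 h2
            · obtain rfl : j = k := by omega
              exact hS.free_last u v hb hv
            · linarith [hD v]
            · linarith [hD v]
      | entry j =>
        apply hA.of_no
        · simp only [layoutWeight, Edge.src, Edge.dst, hb, hv, roleWeight]
          linarith [hD v]
        · simp only [layoutWeight, Edge.src, Edge.dst, hroleb, hrolev, hv, roleWeight]
          linarith [hD' v]
      | free =>
        apply hA.of_no
        · simp only [layoutWeight, Edge.src, Edge.dst, hb, hv, roleWeight]
          linarith [hD v]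
        · simp only [layoutWeight, Edge.src, Edge.dst, hroleb, hrolev, hv, roleWeight]
          linarith [hD' v]
  by_cases hvc : v = c
  · subst hvc
    have hroleu : extendLayout ρ k b v u = ρ u := extendLayout_of_ne hub huv
    cases hu : ρ u with
    | exit j =>
      have hj := hρ.exit_le _ _ hu
      apply hA.of_eq hub hvb
      simp only [layoutWeight, Edge.src, Edge.dst, hrolec, hroleu, hu, hc, roleWeight]
      rw [min_eq_left (by omega)]
    | entry j =>
      have hj := hρ.entry_lt _ _ hu
      apply hA.of_eq hub hvb
      simp only [layoutWeight, Edge.src, Edge.dst, hrolec, hroleu, hu, hc, roleWeight]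
      rw [if_neg (by omega), if_neg (by omega)]
    | free =>
      have hDu := hI.free u hu
      apply hA.of_no
      · simp only [layoutWeight, Edge.src, Edge.dst, hc, hu, roleWeight]
        linarith [hD u]
      · simp only [layoutWeight, Edge.src, Edge.dst, hrolec, hroleu, hu, roleWeight]
        rw [hA.eq u hub, hA.eq v hvb]
        push_cast
        linarith
  have hrolev : extendLayout ρ k b c v = ρ v := extendLayout_of_ne hvb hvc
  by_cases huc : u = c
  · subst huc
    cases hv : ρ v with
    | exit j =>
      have hj := hρ.exit_le _ _ hv
      apply hA.of_eq hub hvb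
      simp only [layoutWeight, Edge.src, Edge.dst, hrolec, hrolev, hv, hc, roleWeight]
      rw [min_eq_right (by omega)]
    | entry j =>
      have hj := hρ.entry_lt _ _ hv
      apply hA.of_eq hub hvb
      simp only [layoutWeight, Edge.src, Edge.dst, hrolec, hrolev, hv, hc, roleWeight]
      rw [if_neg (by omega), if_neg (by omega)]
    | free =>
      have hDv := hI.free v hv
      apply hA.of_no
      · simp only [layoutWeight, Edge.src, Edge.dst, hc, hv, roleWeight]
        linarith [hD u]
      · simp only [layoutWeight, Edge.src, Edge.dst, hrolec, hrolev, hv, roleWeight]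
        rw [hA.eq u hub, hA.eq v hvb]
        push_cast
        linarith
  · have hroleu : extendLayout ρ k b c u = ρ u := extendLayout_of_ne hub huc
    apply hA.of_eq hub hvb
    simp only [layoutWeight, Edge.src, Edge.dst, hroleu, hrolev]

theorem Agree.init (hρ : IsLayout s k ρ) (hb : ρ b = .free) (hc : ρ c = .free) (hbc : b ≠ c) :
    Agree g X k b (initD (layoutWeight g X ρ) s)
      (initD (layoutWeight g X (extendLayout ρ k b c)) s) := by
  have hρ' := hρ.extend hb hc hbc
  have hsb : s ≠ b := by rintro rfl; simp [hρ.start] at hb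
  have hsc : s ≠ c := by rintro rfl; simp [hρ.start] at hc
  constructor
  · intro x hx
    by_cases hxs : s = x
    · simp [initD, hxs]
    by_cases hxc : x = c
    · subst hxc
      simp [initD, hsc, layoutWeight, hρ.start, hρ'.start, extendLayout_exit, hc, roleWeight]
    · simp [initD, hxs, layoutWeight, hρ.start, hρ'.start, extendLayout_of_ne hx hxc]
  · rcases Nat.eq_zero_or_pos k with rfl | hk
    · left
      simp [initD, hsb, layoutWeight, hρ.start, hρ'.start, extendLayout_entry hbc, hb, roleWeight]
    · right
      have : (1 : ℤ) ≤ k := by exact_mod_cast hk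
      simp [initD, hsb, layoutWeight, hρ.start, hρ'.start, extendLayout_entry hbc, hb, roleWeight,
        hk, hk.ne]

end

/-! ### Hitting times -/

/-- The first time at which `P` holds, `⊤` if it never does. -/
noncomputable def hitTime (P : ℕ → Prop) : ℕ∞ := ⨅ (t : ℕ) (_ : P t), (t : ℕ∞)

theorem hitTime_le {P : ℕ → Prop} {t : ℕ} (h : P t) : hitTime P ≤ t := iInf₂_le t h

theorem le_hitTime {P : ℕ → Prop} {a : ℕ∞} (h : ∀ t, P t → a ≤ t) : a ≤ hitTime P := le_iInf₂ h

theorem hitTime_mono {P P' : ℕ → Prop} (h : ∀ t, P t → P' t) : hitTime P' ≤ hitTime P :=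
  le_hitTime fun t ht => hitTime_le (h t ht)

theorem hitTime_spec {P : ℕ → Prop} (h : hitTime P ≠ ⊤) :
    ∃ t : ℕ, P t ∧ hitTime P = t ∧ ∀ t' < t, ¬ P t' := by
  classical
  have hex : ∃ t, P t := by
    by_contra hne
    push Not at hne
    exact h (top_unique (le_hitTime fun t ht => absurd ht (hne t)))
  refine ⟨Nat.find hex, Nat.find_spec hex, le_antisymm (hitTime_le (Nat.find_spec hex)) ?_,
    fun t' ht' => Nat.find_min hex ht'⟩
  exact le_hitTime fun t ht => by exact_mod_cast Nat.find_min' hex ht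

/-- Distinct values in `ℕ∞` from `a` on: at most `M` of them are below `a + M`. -/
theorem card_filter_lt_add_le {ι : Type*} (S : Finset ι) (f : ι → ℕ∞) (a : ℕ∞) (M : ℕ)
    (ha : ∀ i ∈ S, a ≤ f i) (hinj : ∀ i ∈ S, ∀ j ∈ S, f i = f j → f i ≠ ⊤ → i = j) :
    (S.filter fun i => f i < a + M).card ≤ M := by
  induction a using ENat.recTopCoe with
  | top =>
    rw [Finset.card_eq_zero.2]
    · exact Nat.zero_le _
    · refine Finset.filter_eq_empty_iff.2 fun i hi => ?_
      rw [top_unique (ha i hi)]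
      simp
  | coe a =>
    have hfin : ∀ i, f i < (a : ℕ∞) + M → ((f i).toNat : ℕ∞) = f i := fun i h =>
      ENat.natCast_toNat (ne_top_of_lt h)
    calc (S.filter fun i => f i < (a : ℕ∞) + M).card ≤ (Finset.Ico a (a + M)).card := by
          refine Finset.card_le_card_of_injOn (fun i => (f i).toNat) ?_ ?_
          · intro i hi
            obtain ⟨hiS, hi⟩ := Finset.mem_filter.1 (Finset.mem_coe.1 hi)
            have h1 := ha i hiS
            have h2 := hi
            rw [← hfin i hi] at h1 h2
            simp only [Finset.coe_Ico, Set.mem_Ico]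
            exact ⟨by exact_mod_cast h1, by exact_mod_cast h2⟩
          · intro i hi j hj hij
            obtain ⟨hiS, hi⟩ := Finset.mem_filter.1 (Finset.mem_coe.1 hi)
            obtain ⟨hjS, hj⟩ := Finset.mem_filter.1 (Finset.mem_coe.1 hj)
            refine hinj i hiS j hjS ?_ (ne_top_of_lt hi)
            rw [← hfin i hi, ← hfin j hj]
            exact congrArg _ hij
      _ = M := by simp

/-! ### The time needed to find the next pair of vertices -/

/-- The `t`-th step of the computation on the layout `ρ` processes the edge `(b, c)` when the last
exit of the hidden path has its final value and has relaxed `b`. -/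
def Touches (g X : ℤ) (k : ℕ) (s : Fin n) (ρ : Fin n → Role) (A : DecisionTree n)
    (p : Fin n × Fin n) (t : ℕ) : Prop :=
  (∃ e, rootEdge (A.config (layoutWeight g X ρ) s t).1 = some e ∧ e.1 = p) ∧
    (A.config (layoutWeight g X ρ) s t).2 p.1 ≤ X - 1 - k

/-- The first time at which the edge `p` is touched. -/
noncomputable def touchTime (g X : ℤ) (k : ℕ) (s : Fin n) (ρ : Fin n → Role) (A : DecisionTree n)
    (p : Fin n × Fin n) : ℕ∞ :=
  hitTime (Touches g X k s ρ A p)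

/-- The first time at which the last vertex of the hidden path has its final value. -/
noncomputable def finalTime (g X : ℤ) (k : ℕ) (s : Fin n) (ρ : Fin n → Role) (A : DecisionTree n) :
    ℕ∞ :=
  hitTime fun t => ∃ v, ρ v = .exit k ∧ (A.config (layoutWeight g X ρ) s t).2 v = 2 * g * k

section
variable {g X : ℤ} {k : ℕ} {s b c : Fin n} {ρ : Fin n → Role} {A : DecisionTree n}

theorem finalTime_le_runningTime (hρ : IsLayout s k ρ) (hg : 1 ≤ g)
    (hX : (k + 2) * (2 * g + 4) ≤ X) :
    finalTime g X k s ρ A ≤ A.runningTime s (layoutWeight g X ρ) := by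
  refine hitTime_mono fun t ht => ?_
  rw [DecisionTree.run_eq_config] at ht
  obtain ⟨v, hv⟩ := hρ.exists_exit k le_rfl
  have hX0 : 0 ≤ X := le_trans (by positivity) hX
  have hnn := hρ.layoutWeight_mem (M := X.toNat) hg hX (Int.self_le_toNat X)
  exact ⟨v, hv, le_antisymm (ht.exit_le hρ (fun e => (hnn e).1) le_rfl hv)
    ((Invariant.config hρ hg hX A t).exit_bounds hρ hg hX hv).1⟩

theorem touchTime_inj {p q : Fin n × Fin n}
    (h : touchTime g X k s ρ A p = touchTime g X k s ρ A q)
    (hp : touchTime g X k s ρ A p ≠ ⊤) : p = q := by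
  obtain ⟨t, ⟨⟨e, he, hep⟩, -⟩, ht, -⟩ := hitTime_spec hp
  obtain ⟨t', ⟨⟨e', he', heq⟩, -⟩, ht', -⟩ := hitTime_spec (h ▸ hp)
  have : (t : ℕ∞) = t' := ht.symm.trans (h.trans ht')
  obtain rfl : t = t' := by exact_mod_cast this
  rw [he] at he'
  obtain rfl : e = e' := by simpa using he'
  exact hep.symm.trans heq

theorem finalTime_le_touchTime (hρ : IsLayout s k ρ) (hg : 1 ≤ g)
    (hX : (k + 2) * (2 * g + 4) ≤ X) {p : Fin n × Fin n} (hp : ρ p.1 = .free) :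
    finalTime g X k s ρ A ≤ touchTime g X k s ρ A p := by
  refine hitTime_mono fun t ht => ?_
  obtain ⟨v, hv⟩ := hρ.exists_exit k le_rfl
  have hI := Invariant.config hρ hg hX A t
  exact ⟨v, hv, hI.last_final p.1 v hp hv (le_antisymm ht.2 (hI.free _ hp).1)⟩

/-- Up to the time at which the edge `(b, c)` is touched, a computation cannot tell the layout `ρ`
from its extension through `b` and `c`. -/
theorem agree_config (hρ : IsLayout s k ρ) (hb : ρ b = .free) (hc : ρ c = .free) (hbc : b ≠ c)
    (hg : 1 ≤ g) (hX : (k + 3) * (2 * g + 4) ≤ X)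
    (hS : ∀ t, Spread g k ρ (A.config (layoutWeight g X ρ) s t).2) (t : ℕ)
    (ht : ∀ t' < t, ¬ Touches g X k s ρ A (b, c) t') :
    (A.config (layoutWeight g X ρ) s t).1 =
        (A.config (layoutWeight g X (extendLayout ρ k b c)) s t).1 ∧
      Agree g X k b (A.config (layoutWeight g X ρ) s t).2
        (A.config (layoutWeight g X (extendLayout ρ k b c)) s t).2 := by
  induction t with
  | zero => exact ⟨rfl, Agree.init hρ hb hc hbc⟩
  | succ t ih =>
    obtain ⟨h1, h2⟩ := ih fun t' ht' => ht t' (by omega)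
    rw [DecisionTree.config_succ, DecisionTree.config_succ]
    refine step_agree _ _ h1 h2 fun e he => ?_
    refine h2.relax hρ hb hc hbc hg hX
      (Invariant.config hρ hg (by linarith) A t) (hS t) e fun h => ?_
    exact ht t (by omega) ⟨⟨e, he, Prod.ext h.1 h.2.1⟩, h.2.2⟩

/-- The vertex `c` does not get its final value before the edge `(b, c)` has been processed. -/
theorem touchTime_le_finalTime (hρ : IsLayout s k ρ) (hb : ρ b = .free) (hc : ρ c = .free)
    (hbc : b ≠ c) (hg : 1 ≤ g) (hX : (k + 3) * (2 * g + 4) ≤ X)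
    (hS : ∀ t, Spread g k ρ (A.config (layoutWeight g X ρ) s t).2) :
    touchTime g X k s ρ A (b, c) ≤ finalTime g X (k + 1) s (extendLayout ρ k b c) A := by
  refine le_hitTime fun t ⟨v, hv, hfin⟩ => ?_
  by_contra hlt
  push Not at hlt
  have hρ' := hρ.extend hb hc hbc
  obtain rfl : v = c :=
    hρ'.inj v c (hv.trans extendLayout_exit.symm) (by simp [hv])
  have hno : ∀ t' < t, ¬ Touches g X k s ρ A (b, v) t' := fun t' ht' h =>
    absurd ((hitTime_le h).trans (by exact_mod_cast ht'.le)) (not_le.2 hlt)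
  have hA := (agree_config hρ hb hc hbc hg hX hS t hno).2
  rw [hA.eq v hbc.symm] at hfin
  have hX' : (k + 2) * (2 * g + 4) ≤ X := by linarith
  have := (Invariant.config hρ hg hX' A t).free v hc
  have := (index_mul_le hg le_rfl : (k : ℤ) * g ≤ k * g ∧ _).2
  push_cast at hfin
  linarith

/-- With path edges of weight `g ≥ k`, the range of values that the invariant allows to free vertices
is small enough. -/
theorem Invariant.spread {D : Fin n → ℤ} (hI : Invariant g X k ρ D) (hρ : IsLayout s k ρ)
    (hg : 1 ≤ g) (hX : (k + 2) * (2 * g + 4) ≤ X) (hk : k ≤ g) : Spread g k ρ D := by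
  constructor
  · intro x y hx hy
    linarith [(hI.free x hx).1, (hI.free y hy).2]
  · intro x y hx hy
    linarith [(hI.free x hx).1, (hI.exit_bounds hρ hg hX hy).2]
  · intro x y hx hy hne
    rcases hI.exit x k hx with h | h
    · exact absurd h hne
    · linarith [(hI.free y hy).2]

/-- If `(b, c)` is the last of the edges between free vertices to be touched, then all free vertices
have been relaxed by the last exit by that time. So the D-values stay close together on the
extended layout. -/
theorem spread_extend (hρ : IsLayout s k ρ) (hb : ρ b = .free) (hc : ρ c = .free) (hbc : b ≠ c)
    (hg : 1 ≤ g) (hX : (k + 3) * (2 * g + 4) ≤ X)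
    (hS : ∀ t, Spread g k ρ (A.config (layoutWeight g X ρ) s t).2)
    (hfin : touchTime g X k s ρ A (b, c) ≠ ⊤)
    (hmax : ∀ x y, ρ x = .free → ρ y = .free → x ≠ y →
      touchTime g X k s ρ A (x, y) ≤ touchTime g X k s ρ A (b, c)) (t : ℕ) :
    Spread g (k + 1) (extendLayout ρ k b c)
      (A.config (layoutWeight g X (extendLayout ρ k b c)) s t).2 := by
  have hρ' := hρ.extend hb hc hbc
  obtain ⟨τ, hτ, hτeq, hτmin⟩ := hitTime_spec hfin
  have hI' := Invariant.config hρ' hg (by push_cast; linarith) A t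
  have hfree : ∀ x, extendLayout ρ k b c x = .free → x ≠ b ∧ x ≠ c ∧ ρ x = .free := by
    intro x hx
    have h1 : x ≠ b := by rintro rfl; simp [extendLayout_entry hbc] at hx
    have h2 : x ≠ c := by rintro rfl; simp [extendLayout_exit] at hx
    exact ⟨h1, h2, (extendLayout_of_ne h1 h2).symm.trans hx⟩
  have hlast : ∀ x, extendLayout ρ k b c x = .exit (k + 1) → x = c := fun x hx =>
    hρ'.inj x c (hx.trans extendLayout_exit.symm) (by simp [hx])
  rcases le_total t τ with hle | hle
  · have hA := (agree_config hρ hb hc hbc hg hX hS t fun t' ht' => hτmin t' (by omega)).2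
    constructor
    · intro x y hx hy
      obtain ⟨hxb, -, hx⟩ := hfree x hx
      obtain ⟨hyb, -, hy⟩ := hfree y hy
      rw [hA.eq x hxb, hA.eq y hyb]
      exact (hS t).free_free x y hx hy
    · intro x y hx hy
      obtain ⟨hxb, -, hx⟩ := hfree x hx
      rw [hlast y hy, hA.eq x hxb, hA.eq c hbc.symm]
      exact (hS t).free_free x c hx hc
    · intro x y hx hy _
      obtain ⟨hyb, -, hy⟩ := hfree y hy
      rw [hlast x hx, hA.eq c hbc.symm, hA.eq y hyb]
      exact (hS t).free_free c y hc hy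
  · have hA := (agree_config hρ hb hc hbc hg hX hS τ hτmin).2
    have hlow : ∀ y, y ≠ b → ρ y = .free →
        (A.config (layoutWeight g X (extendLayout ρ k b c)) s t).2 y ≤ X - 1 - k := by
      intro y hyb hy
      refine (A.config_antitone _ s y hle).trans ?_
      simp only
      rw [hA.eq y hyb]
      -- the edge `(y, b)` has been touched by the time `τ`
      have h1 := hmax y b hy hb hyb
      obtain ⟨t', ht', ht'eq, -⟩ := hitTime_spec (ne_top_of_le_ne_top hfin h1)
      have h2 : (t' : ℕ∞) ≤ τ := by
        rw [← ht'eq, ← hτeq]; exact h1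
      exact (A.config_antitone _ s y (by exact_mod_cast h2)).trans ht'.2
    constructor
    · intro x y hx hy
      have h1 := (hI'.free x hx).1
      obtain ⟨hyb, -, hy⟩ := hfree y hy
      have h2 := hlow y hyb hy
      push_cast at h1
      linarith
    · intro x y hx hy
      have h1 := (hI'.free x hx).1
      obtain rfl := hlast y hy
      have h2 := hlow y hbc.symm hc
      push_cast at h1
      linarith
    · intro x y hx hy hne
      obtain ⟨hyb, -, hy⟩ := hfree y hy
      have h2 := hlow y hyb hy
      rcases hI'.exit x _ hx with h | h
      · exact absurd h hne
      · have h1 := h.1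
        push_cast at h1
        linarith

end

/-! ### Counting free pairs -/

open Classical in
/-- The ordered pairs of distinct free vertices of a layout. -/
noncomputable def freePairs (ρ : Fin n → Role) : Finset (Fin n × Fin n) :=
  (Finset.univ.filter fun v => ρ v = .free).offDiag

theorem mem_freePairs {ρ : Fin n → Role} {p : Fin n × Fin n} :
    p ∈ freePairs ρ ↔ ρ p.1 = .free ∧ ρ p.2 = .free ∧ p.1 ≠ p.2 := by
  simp [freePairs]

open Classical in
/-- A layout with `k` pairs leaves all but `2 * k + 1` vertices free. -/
theorem IsLayout.card_free {s : Fin n} {k : ℕ} {ρ : Fin n → Role} (hρ : IsLayout s k ρ) :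
    n ≤ (Finset.univ.filter fun v => ρ v = .free).card + (2 * k + 1) := by
  have h1 : (Finset.univ.filter fun v => ρ v ≠ .free).card ≤
      (((Finset.range (k + 1)).image Role.exit) ∪ ((Finset.range k).image Role.entry)).card := by
    refine Finset.card_le_card_of_injOn ρ ?_ ?_
    · intro v hv
      have hv : ρ v ≠ .free := by simpa using hv
      simp only [Finset.coe_union, Set.mem_union, Finset.mem_coe, Finset.mem_image,
        Finset.mem_range]
      cases h : ρ v with
      | exit j => exact Or.inl ⟨j, Nat.lt_succ_of_le (hρ.exit_le v j h), rfl⟩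
      | entry j => exact Or.inr ⟨j, hρ.entry_lt v j h, rfl⟩
      | free => exact absurd h hv
    · intro u hu v _ huv
      exact hρ.inj u v huv (by simpa using hu)
  have h2 : (((Finset.range (k + 1)).image Role.exit) ∪
      ((Finset.range k).image Role.entry)).card ≤ 2 * k + 1 := by
    refine (Finset.card_union_le _ _).trans ?_
    have := Finset.card_image_le (s := Finset.range (k + 1)) (f := Role.exit)
    have := Finset.card_image_le (s := Finset.range k) (f := Role.entry)
    simp only [Finset.card_range] at *
    omega
  have h3 := Finset.card_filter_add_card_filter_not (s := (Finset.univ : Finset (Fin n)))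
    (fun v => ρ v = Role.free)
  simp only [Finset.card_univ, Fintype.card_fin] at h3
  have h4 : (Finset.univ.filter fun v => ¬ ρ v = Role.free).card ≤ 2 * k + 1 := h1.trans h2
  omega

theorem IsLayout.le_card_freePairs {s : Fin n} {k : ℕ} {ρ : Fin n → Role} (hρ : IsLayout s k ρ)
    (hn : 16 ≤ n) (hk : 4 * k ≤ n) : n ^ 2 ≤ 16 * (freePairs ρ).card := by
  classical
  have h := hρ.card_free
  unfold freePairs
  rw [Finset.offDiag_card]
  obtain ⟨m, hm⟩ : ∃ m, (Finset.univ.filter fun v => ρ v = Role.free).card = m + 1 :=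
    ⟨_, (Nat.succ_pred_eq_of_pos (by omega)).symm⟩
  rw [hm] at h ⊢
  have : (m + 1) * (m + 1) - (m + 1) = m * (m + 1) := by
    rw [Nat.mul_succ]
    simp [Nat.mul_comm]
  rw [this]
  have h1 : n ≤ 2 * m + 4 := by omega
  nlinarith

theorem isLayout_zero (s : Fin n) :
    IsLayout s 0 (Function.update (fun _ => Role.free) s (.exit 0)) := by
  have key : ∀ v, Function.update (fun _ => Role.free) s (.exit 0) v ≠ .free → v = s := by
    intro v hv
    by_contra h
    simp [Function.update_of_ne h] at hv
  constructor
  · simp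
  · intro v j h
    obtain rfl := key v (by simp [h])
    simp at h
    omega
  · intro v j h
    obtain rfl := key v (by simp [h])
    simp at h
  · intro j hj
    obtain rfl : j = 0 := by omega
    exact ⟨s, by simp⟩
  · intro j hj
    omega
  · intro u v huv hu
    rw [key u hu, key v (huv ▸ hu)]

/-! ### The lower bounds -/

section
variable {g X : ℤ} {k : ℕ} {s : Fin n} {ρ : Fin n → Role}

/-- One phase of the adversary against a deterministic algorithm: extending the hidden path by the
edge between free vertices that is touched last costs the algorithm `Q` steps. -/
theorem exists_extension_of_spread {A : DecisionTree n} {Q : ℕ} {a : ℕ∞} (hρ : IsLayout s k ρ)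
    (hg : 1 ≤ g) (hX : (k + 3) * (2 * g + 4) ≤ X)
    (hS : ∀ t, Spread g k ρ (A.config (layoutWeight g X ρ) s t).2)
    (hQ : Q < (freePairs ρ).card) (ha : a ≤ finalTime g X k s ρ A) :
    ∃ ρ', IsLayout s (k + 1) ρ' ∧ a + Q ≤ finalTime g X (k + 1) s ρ' A ∧
      (finalTime g X (k + 1) s ρ' A = ⊤ ∨
        ∀ t, Spread g (k + 1) ρ' (A.config (layoutWeight g X ρ') s t).2) := by
  have hne : (freePairs ρ).Nonempty := Finset.card_pos.1 (by omega)
  obtain ⟨⟨b, c⟩, hp, hmax⟩ := Finset.exists_max_image (freePairs ρ) (touchTime g X k s ρ A) hne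
  obtain ⟨hb, hc, hbc⟩ := mem_freePairs.1 hp
  have hX' : (k + 2) * (2 * g + 4) ≤ X := by linarith
  have hle := touchTime_le_finalTime hρ hb hc hbc hg hX hS
  refine ⟨extendLayout ρ k b c, hρ.extend hb hc hbc, ?_, ?_⟩
  · refine le_trans ?_ hle
    by_contra hlt
    push Not at hlt
    have h1 := card_filter_lt_add_le (freePairs ρ) (touchTime g X k s ρ A) a Q
      (fun p hp => ha.trans (finalTime_le_touchTime hρ hg hX' (mem_freePairs.1 hp).1))
      (fun p _ q _ => touchTime_inj)
    rw [Finset.filter_true_of_mem fun p hp => (hmax p hp).trans_lt hlt] at h1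
    omega
  · by_cases hfin : touchTime g X k s ρ A (b, c) = ⊤
    · exact Or.inl (top_unique (hfin ▸ hle))
    · exact Or.inr (spread_extend hρ hb hc hbc hg hX hS hfin fun x y hx hy hxy =>
        hmax (x, y) (mem_freePairs.2 ⟨hx, hy, hxy⟩))

/-- `K` phases cost the algorithm `K * Q` steps. The path may have fewer than `K` pairs: if some pair is
never touched, the final time is `⊤` as soon as the path is extended by that pair. -/
theorem exists_layout_le_finalTime {K Q : ℕ} (s : Fin n) (A : DecisionTree n)
    (hg : 1 ≤ g) (hX : (K + 2) * (2 * g + 4) ≤ X)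
    (hQ : ∀ k < K, ∀ ρ : Fin n → Role, IsLayout s k ρ → Q < (freePairs ρ).card) :
    ∃ k ≤ K, ∃ ρ, IsLayout s k ρ ∧ ((K * Q : ℕ) : ℕ∞) ≤ finalTime g X k s ρ A := by
  have key : ∀ k ≤ K, (∃ j ≤ k, ∃ ρ, IsLayout s j ρ ∧ finalTime g X j s ρ A = ⊤) ∨
      ∃ ρ, IsLayout s k ρ ∧ ((k * Q : ℕ) : ℕ∞) ≤ finalTime g X k s ρ A ∧
        ∀ t, Spread g k ρ (A.config (layoutWeight g X ρ) s t).2 := by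
    intro k hk
    have hXk : ∀ j ≤ K, ((j : ℤ) + 2) * (2 * g + 4) ≤ X := fun j hj => by
      have : (j : ℤ) ≤ K := by exact_mod_cast hj
      exact le_trans (mul_le_mul_of_nonneg_right (by linarith) (by linarith)) hX
    induction k with
    | zero =>
      refine Or.inr ⟨_, isLayout_zero s, by simp, fun t => ?_⟩
      exact (Invariant.config (isLayout_zero s) hg (hXk 0 hk) A t).spread (isLayout_zero s) hg
        (hXk 0 hk) (by push_cast; linarith)
    | succ k ih =>
      rcases ih (by omega) with ⟨j, hj, h⟩ | ⟨ρ, hρ, hle, hS⟩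
      · exact Or.inl ⟨j, by omega, h⟩
      · have hXk' := hXk (k + 1) hk
        push_cast at hXk'
        obtain ⟨ρ', hρ', hle', htop | hS'⟩ := exists_extension_of_spread hρ hg (by linarith) hS
          (hQ k hk ρ hρ) hle
        · exact Or.inl ⟨k + 1, le_rfl, ρ', hρ', htop⟩
        · refine Or.inr ⟨ρ', hρ', ?_, hS'⟩
          rw [Nat.succ_mul]
          push_cast at hle' ⊢
          exact hle'
  rcases key K le_rfl with ⟨j, hj, ρ, hρ, h⟩ | ⟨ρ, hρ, h, -⟩
  · exact ⟨j, hj, ρ, hρ, h ▸ le_top⟩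
  · exact ⟨K, le_rfl, ρ, hρ, h⟩

/-- A uniformly random extension of the hidden path costs a deterministic algorithm `Q` steps on
average if `4 * Q` extensions are available: at most half of them cost less than `2 * Q`. -/
theorem sum_finalTime_extend {A : DecisionTree n} {Q : ℕ} (hρ : IsLayout s k ρ)
    (hg : 1 ≤ g) (hkg : k ≤ g) (hX : (k + 3) * (2 * g + 4) ≤ X)
    (hQ : 4 * Q ≤ (freePairs ρ).card) :
    (freePairs ρ).card * ((finalTime g X k s ρ A : ℝ≥0∞) + Q) ≤
      ∑ p ∈ freePairs ρ, (finalTime g X (k + 1) s (extendLayout ρ k p.1 p.2) A : ℝ≥0∞) := by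
  classical
  have hX' : (k + 2) * (2 * g + 4) ≤ X := by linarith
  have hS : ∀ t, Spread g k ρ (A.config (layoutWeight g X ρ) s t).2 := fun t =>
    (Invariant.config hρ hg hX' A t).spread hρ hg hX' hkg
  set S := freePairs ρ
  set a := finalTime g X k s ρ A
  set f := fun p : Fin n × Fin n => touchTime g X k s ρ A p
  have ha : ∀ p ∈ S, a ≤ f p := fun p hp =>
    finalTime_le_touchTime hρ hg hX' (mem_freePairs.1 hp).1
  have hcard := card_filter_lt_add_le S f a (2 * Q) ha (fun p _ q _ => touchTime_inj)
  have hsplit := Finset.card_filter_add_card_filter_not (s := S) (fun p => f p < a + (2 * Q : ℕ))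
  set m := (S.filter fun p => ¬ f p < a + (2 * Q : ℕ)).card
  have hm : S.card * Q ≤ m * (2 * Q) := by
    have : S.card ≤ m * 2 := by omega
    calc S.card * Q ≤ m * 2 * Q := Nat.mul_le_mul_right _ this
      _ = m * (2 * Q) := by ring
  calc (S.card : ℝ≥0∞) * ((a : ℝ≥0∞) + Q)
      ≤ S.card * (a : ℝ≥0∞) + m * ((2 * Q : ℕ) : ℝ≥0∞) := by
        rw [mul_add]
        refine add_le_add le_rfl ?_
        exact_mod_cast hm
    _ = ∑ p ∈ S, ((a : ℝ≥0∞) +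
          if ¬ f p < a + (2 * Q : ℕ) then ((2 * Q : ℕ) : ℝ≥0∞) else 0) := by
        rw [Finset.sum_add_distrib, ← Finset.sum_filter]
        simp [m]
    _ ≤ ∑ p ∈ S, (finalTime g X (k + 1) s (extendLayout ρ k p.1 p.2) A : ℝ≥0∞) := by
        refine Finset.sum_le_sum fun p hp => ?_
        obtain ⟨hb, hc, hbc⟩ := mem_freePairs.1 hp
        have h1 : (f p : ℝ≥0∞) ≤
            (finalTime g X (k + 1) s (extendLayout ρ k p.1 p.2) A : ℝ≥0∞) :=
          ENat.toENNReal_le.2 (touchTime_le_finalTime hρ hb hc hbc hg hX hS)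
        refine le_trans ?_ h1
        split_ifs with h
        · rw [add_zero]
          exact ENat.toENNReal_le.2 (ha p hp)
        · have h2 := ENat.toENNReal_le.2 (not_lt.1 h)
          rw [ENat.toENNReal_add] at h2
          exact h2

/-- Expected first time at which the last vertex of the hidden path has its final value. -/
noncomputable def expectedFinalTime (g X : ℤ) (k : ℕ) (s : Fin n) (ρ : Fin n → Role)
    (R : PMF (DecisionTree n)) : ℝ≥0∞ :=
  ∑' A : DecisionTree n, R A * (finalTime g X k s ρ A : ℝ≥0∞)

/-- One phase of the adversary against a randomized algorithm. -/
theorem exists_extension_le_expectedFinalTime {R : PMF (DecisionTree n)} {Q : ℕ}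
    (hρ : IsLayout s k ρ) (hg : 1 ≤ g) (hkg : k ≤ g) (hX : (k + 3) * (2 * g + 4) ≤ X)
    (hQ : 4 * Q ≤ (freePairs ρ).card) (hne : 0 < (freePairs ρ).card) :
    ∃ ρ', IsLayout s (k + 1) ρ' ∧
      expectedFinalTime g X k s ρ R + Q ≤ expectedFinalTime g X (k + 1) s ρ' R := by
  obtain ⟨⟨b, c⟩, hp, hmax⟩ := Finset.exists_max_image (freePairs ρ)
    (fun p => expectedFinalTime g X (k + 1) s (extendLayout ρ k p.1 p.2) R) (Finset.card_pos.1 hne)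
  obtain ⟨hb, hc, hbc⟩ := mem_freePairs.1 hp
  refine ⟨extendLayout ρ k b c, hρ.extend hb hc hbc, ?_⟩
  have h0 : ((freePairs ρ).card : ℝ≥0∞) ≠ 0 := by exact_mod_cast hne.ne'
  rw [← ENNReal.mul_le_mul_iff_right h0 (ENNReal.natCast_ne_top _)]
  calc ((freePairs ρ).card : ℝ≥0∞) * (expectedFinalTime g X k s ρ R + Q)
      = ∑' A, R A * ((freePairs ρ).card * ((finalTime g X k s ρ A : ℝ≥0∞) + Q)) := by
        have hsum : (Q : ℝ≥0∞) = ∑' A, R A * Q := by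
          rw [ENNReal.tsum_mul_right, R.tsum_coe, one_mul]
        rw [expectedFinalTime]
        conv_lhs => rw [hsum]
        rw [← ENNReal.tsum_add, ← ENNReal.tsum_mul_left]
        exact tsum_congr fun A => by ring
    _ ≤ ∑' A, R A * ∑ p ∈ freePairs ρ,
          (finalTime g X (k + 1) s (extendLayout ρ k p.1 p.2) A : ℝ≥0∞) :=
        ENNReal.tsum_le_tsum fun A =>
          mul_le_mul_right (sum_finalTime_extend hρ hg hkg hX hQ) _
    _ = ∑ p ∈ freePairs ρ, expectedFinalTime g X (k + 1) s (extendLayout ρ k p.1 p.2) R := by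
        simp only [Finset.mul_sum, expectedFinalTime]
        exact Summable.tsum_finsetSum fun _ _ => ENNReal.summable
    _ ≤ (freePairs ρ).card * expectedFinalTime g X (k + 1) s (extendLayout ρ k b c) R := by
        rw [← nsmul_eq_mul]
        exact Finset.sum_le_card_nsmul _ _ _ hmax

theorem exists_layout_le_expectedFinalTime {K Q : ℕ} (s : Fin n) (R : PMF (DecisionTree n))
    (hg : 1 ≤ g) (hKg : K ≤ g) (hX : (K + 2) * (2 * g + 4) ≤ X)
    (hQ : ∀ k < K, ∀ ρ : Fin n → Role, IsLayout s k ρ →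
      4 * Q ≤ (freePairs ρ).card ∧ 0 < (freePairs ρ).card) :
    ∃ ρ, IsLayout s K ρ ∧ ((K * Q : ℕ) : ℝ≥0∞) ≤ expectedFinalTime g X K s ρ R := by
  have key : ∀ k ≤ K, ∃ ρ, IsLayout s k ρ ∧
      ((k * Q : ℕ) : ℝ≥0∞) ≤ expectedFinalTime g X k s ρ R := by
    intro k hk
    induction k with
    | zero => exact ⟨_, isLayout_zero s, by simp⟩
    | succ k ih =>
      obtain ⟨ρ, hρ, hle⟩ := ih (by omega)
      have hkK : (k : ℤ) + 1 ≤ K := by exact_mod_cast hk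
      obtain ⟨ρ', hρ', hle'⟩ := exists_extension_le_expectedFinalTime (X := X) (R := R) hρ hg
        (by linarith)
        (le_trans (mul_le_mul_of_nonneg_right (by linarith) (by linarith)) hX)
        (hQ k hk ρ hρ).1 (hQ k hk ρ hρ).2
      refine ⟨ρ', hρ', le_trans ?_ hle'⟩
      rw [Nat.succ_mul]
      push_cast at hle ⊢
      gcongr
  exact key K le_rfl

theorem expectedFinalTime_le_expectedRunningTime {R : PMF (DecisionTree n)} (hρ : IsLayout s k ρ)
    (hg : 1 ≤ g) (hX : (k + 2) * (2 * g + 4) ≤ X) :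
    expectedFinalTime g X k s ρ R ≤ expectedRunningTime R s (layoutWeight g X ρ) :=
  ENNReal.tsum_le_tsum fun _ =>
    mul_le_mul_right (ENat.toENNReal_le.2 (finalTime_le_runningTime hρ hg hX)) _

end

/-- `n / 4` phases of `n ^ 2 / 64` steps are a cubic number of steps. -/
theorem cubic_le_phases {n : ℕ} (hn : 16 ≤ n) :
    ((1 / 1024 : ℝ≥0) : ℝ≥0∞) * (n : ℝ≥0∞) ^ 3 ≤ ((n / 4 * (n ^ 2 / 64) : ℕ) : ℝ≥0∞) := by
  have h : n ^ 3 ≤ 1024 * (n / 4 * (n ^ 2 / 64)) := by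
    have h1 : n ≤ 8 * (n / 4) := by omega
    have h2 : n ^ 2 ≤ 128 * (n ^ 2 / 64) := by
      have : 256 ≤ n ^ 2 := by nlinarith
      omega
    calc n ^ 3 = n * n ^ 2 := by ring
      _ ≤ 8 * (n / 4) * (128 * (n ^ 2 / 64)) := Nat.mul_le_mul h1 h2
      _ = 1024 * (n / 4 * (n ^ 2 / 64)) := by ring
  have h' : (1 / 1024 : ℝ≥0) * (n : ℝ≥0) ^ 3 ≤ ((n / 4 * (n ^ 2 / 64) : ℕ) : ℝ≥0) := by
    have h3 : ((n ^ 3 : ℕ) : ℝ≥0) ≤ ((1024 * (n / 4 * (n ^ 2 / 64)) : ℕ) : ℝ≥0) := by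
      exact_mod_cast h
    rw [Nat.cast_mul 1024] at h3
    push_cast only [Nat.cast_pow, Nat.cast_ofNat] at h3
    calc (1 / 1024 : ℝ≥0) * (n : ℝ≥0) ^ 3
        ≤ 1 / 1024 * (1024 * ((n / 4 * (n ^ 2 / 64) : ℕ) : ℝ≥0)) := by gcongr
      _ = _ := by rw [← mul_assoc]; norm_num
  exact_mod_cast h'

end QueryRelaxation

open QueryRelaxation in
theorem theorem1 :
    -- (a) deterministic algorithms
    (∃ c : ℝ≥0, 0 < c ∧ ∃ C n₀ : ℕ, ∀ n ≥ n₀, ∀ s : Fin n,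
      ∀ A : QueryRelaxation.DecisionTree n,
        A.Solves s (QueryRelaxation.nonnegSymm n (C * n)) →
        ∃ ℓ ∈ QueryRelaxation.nonnegSymm n (C * n),
          (c : ℝ≥0∞) * (n : ℝ≥0∞) ^ 3 ≤ (A.runningTime s ℓ : ℝ≥0∞)) ∧
    -- (b) randomized algorithms
    (∃ c : ℝ≥0, 0 < c ∧ ∃ C n₀ : ℕ, ∀ n ≥ n₀, ∀ s : Fin n,
      ∀ R : PMF (QueryRelaxation.DecisionTree n),
        (∀ A ∈ R.support, A.Solves s (QueryRelaxation.nonnegSymm n (C * n ^ 2))) →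
        ∃ ℓ ∈ QueryRelaxation.nonnegSymm n (C * n ^ 2),
          (c : ℝ≥0∞) * (n : ℝ≥0∞) ^ 3 ≤ QueryRelaxation.expectedRunningTime R s ℓ) := by
  have hpairs : ∀ n ≥ 16, ∀ s : Fin n, ∀ k < n / 4, ∀ ρ : Fin n → Role, IsLayout s k ρ →
      4 * (n ^ 2 / 64) ≤ (freePairs ρ).card ∧ 16 ≤ (freePairs ρ).card := by
    intro n hn s k hk ρ hρ
    have h1 := hρ.le_card_freePairs hn (by omega)
    have h2 : 256 ≤ n ^ 2 := by nlinarith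
    omega
  refine ⟨⟨1 / 1024, by positivity, 6, 16, fun n hn s A _ => ?_⟩,
    ⟨1 / 1024, by positivity, 6, 16, fun n hn s R _ => ?_⟩⟩
  · have h4 : 4 * ((n / 4 : ℕ) : ℤ) ≤ n := by exact_mod_cast Nat.mul_div_le n 4
    have hn' : (16 : ℤ) ≤ n := by exact_mod_cast hn
    have hX : (((n / 4 : ℕ) : ℤ) + 2) * (2 * 1 + 4) ≤ 6 * n := by linarith
    obtain ⟨k, hk, ρ, hρ, hle⟩ := exists_layout_le_finalTime (g := 1) (X := 6 * n)
      (K := n / 4) (Q := n ^ 2 / 64) s A le_rfl hX fun k hk ρ hρ => by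
        have := hpairs n hn s k hk ρ hρ
        omega
    have hk' : (k : ℤ) ≤ (n / 4 : ℕ) := by exact_mod_cast hk
    have hXk : ((k : ℤ) + 2) * (2 * 1 + 4) ≤ 6 * n := by linarith
    refine ⟨layoutWeight 1 (6 * n) ρ, hρ.layoutWeight_mem le_rfl hXk (by push_cast; rfl), ?_⟩
    refine (cubic_le_phases hn).trans ?_
    have := ENat.toENNReal_le.2 (hle.trans (finalTime_le_runningTime hρ le_rfl hXk))
    simpa using this
  · have h4 : 4 * ((n / 4 : ℕ) : ℤ) ≤ n := by exact_mod_cast Nat.mul_div_le n 4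
    have hn' : (16 : ℤ) ≤ n := by exact_mod_cast hn
    have hX : (((n / 4 : ℕ) : ℤ) + 2) * (2 * n + 4) ≤ 6 * n ^ 2 := by nlinarith
    obtain ⟨ρ, hρ, hle⟩ := exists_layout_le_expectedFinalTime (g := n) (X := 6 * n ^ 2)
      (K := n / 4) (Q := n ^ 2 / 64) s R (by linarith) (by linarith) hX fun k hk ρ hρ => by
        have := hpairs n hn s k hk ρ hρ
        omega
    refine ⟨layoutWeight n (6 * n ^ 2) ρ,
      hρ.layoutWeight_mem (by linarith) hX (by push_cast; rfl), ?_⟩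
    exact (cubic_le_phases hn).trans (hle.trans
      (expectedFinalTime_le_expectedRunningTime hρ (by linarith) hX))
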